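/- **Definitions.** A *median operation* on a set $X$ is a map $m:X^3\to X$ with $m(x,y,z)=m(y,x,z)=m(x,z,y)$, $m(x,y,x)=x$ and $m(m(x,y,z),u,v)=m(m(x,u,v),m(y,u,v),z)$. Its cells are $[x,y]=\{z: m(x,y,z)=z\}$; $A\subseteq X$ is convex if $[x,y]\subseteq A$ for $x,y\in A$; a nonempty convex $A$ is retractible with associated map $\psi:X\to X$, $\psi(X)=A$, if $[x,a]\cap A=[\psi(x),a]$ for all $x\in X$, $a\in A$. A *folding* is a map $\psi:X\to X$ with $\psi(m(x,y,z))=m(\psi(x),y,\psi(z))$. $m$ is *locally linear* if $[x,y]=[x,z]\cup[z,y]$ for all $x,y$ and $z\in[x,y]$, and *simplicial* if all cells are finite. A *median group operation* on a group $G$ is a median operation $m$ with $u\,m(x,y,z)=m(ux,uy,uz)$. **Setting.** Let a group $H$ act freely on a nonempty set $X$, let $b_1\in X$ be a base point, and let $B\ni b_1$ be a set of representatives of the $H$-orbits (for every $b_1\in X$ there is one). Let $F$ be the free group on $B\setminus\{b_1\}$, $\widehat H=H*F$, and let $\iota:X\to\widehat H$ be given by $\iota(hb_1)=h$ and $\iota(hb)=h\cdot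 b$ for $h\in H$, $b\in B\setminus\{b_1\}$. Let $l$ be the word length on $\widehat H$ with respect to $(H\setminus\{1\})\cup(B\setminus\{b_1\})^{\pm1}$, and put $u\le v$ iff $l(v)=l(u)+l(u^{-1}v)$. Let $\wedge$ denote the meet for $\le$, $Y(u,v,w)=(u\wedge v)\vee(v\wedge w)\vee(w\wedge u)$, and let $\varphi(w)$ be the greatest $x\in X$ with $\iota(x)\le w$. Let $\mathcal M(X)$ be the set of median operations $m$ on $X$ with $m(hx,hy,hz)=h\,m(x,y,z)$ for all $h\in H$, and $\mathcal M(\widehat H,\varphi)$ the set of median group operations on $\widehat H$ for which $\iota\circ\varphi$ is a folding. **Theorem.** 0. The relation $\le$ is a partial order on $\widehat H$ with least element $1$, any two elements below a common element are comparable, and $u\wedge v$, $Y(u,v,w)$, $\varphi(w)$ exist for all $u,v,w$. The canonical map $H\to\widehat H$ and $\iota$ are injective, $\iota$ and $\varphi$ are $H$-equivariant, $\varphi\circ\iota=\mathrm{id}_X$, $\iota(b_1)=1$, $\iota(Hb_1)=H$, and $\iota(X)$ generates $\widehat H$. 1. For every $\widehat m\in\mathcal M(\widehat H,\varphi)$ the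 set $\iota(X)$ is a retractible convex subset of $(\widehat H,\widehat m)$ with associated map $\iota\circ\varphi$, and restriction to $X$ is a bijection $\mathcal M(\widehat H,\varphi)\to\mathcal M(X)$. It restricts to bijections between the subsets of locally linear operations, and between the subsets of simplicial operations. 2. Let $m\in\mathcal M(X)$. The unique $\widehat m\in\mathcal M(\widehat H,\varphi)$ extending $m$ is, with $t=Y(u,v,w)$, $$\widehat m(u,v,w)=t\cdot\iota\bigl(m(\varphi(t^{-1}u),\varphi(t^{-1}v),\varphi(t^{-1}w))\bigr),$$ and $\widehat m$ is locally linear (simplicial) whenever $m$ is. 3. With $a=u\wedge v$, the operation $u\cap v:=\widehat m(u,1,v)$ is given by $u\cap v=a\cdot\iota\bigl(m(\varphi(a^{-1}u),\varphi(a^{-1}),\varphi(a^{-1}v))\bigr)$, and the order $u\subset v:\Leftrightarrow u\cap v=u$ satisfies $u\subset v\Leftrightarrow a^{-1}u\in\iota([\varphi(a^{-1}),\varphi(a^{-1}v)])$. In particular $u\subset v$ if $u\le v$ and $b_1\in[\varphi(u^{-1}),\varphi(u^{-1}v)]$. 4. Let $v\in\widehat H\setminus\{1\}$, and let $C_v$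 be the set of all $w\le v$ such that $\varphi(w^{-1})\in B$ and such that $\varphi(w^{-1})=b_1$ implies $\varphi(w^{-1}v)\ne b_1$. Then $C_v$ is finite and nonempty and can be written as $w_1<\dots<w_n$ for $\le$. Put $e_i=w_i\,\iota(\varphi(w_i^{-1}))$ for $1\le i\le n$ and $e_{n+1}=v$. Then $e_1=1$, $e_i\le w_i\le e_{i+1}$, $e_i\ne e_{i+1}$ and $e_{i+1}=w_i\,\iota(\varphi(w_i^{-1}v))$ for $1\le i\le n$. For every $m\in\mathcal M(X)$, with $\widehat m$ and $\subset$ as above: $e_1\subset e_2\subset\dots\subset e_{n+1}$; the cell $[1,v]$ of $\widehat m$ is the union of the cells $[e_i,e_{i+1}]=w_i\,\iota([\varphi(w_i^{-1}),\varphi(w_i^{-1}v)])$, $1\le i\le n$; $u\subset u'$ whenever $u\in[e_i,e_{i+1}]$, $u'\in[e_k,e_{k+1}]$ and $i<k$; and for $x,x'\in[\varphi(w_i^{-1}),\varphi(w_i^{-1}v)]$ one has $w_i\iota(x)\subset w_i\iota(x')$ if and only if $x\in[\varphi(w_i^{-1}),x']$. -/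

import Mathlib

namespace FreeMedian

section MedianSets

variable {X : Type*}

/-- The median set axioms for a ternary operation: symmetry, absorption, selfdistributivity. -/
structure IsMedian (m : X → X → X → X) : Prop where
  symm_left : ∀ x y z, m x y z = m y x z
  symm_right : ∀ x y z, m x y z = m x z y
  absorb : ∀ x y, m x y x = x
  selfdistrib : ∀ x y z u v, m (m x y z) u v = m (m x u v) (m y u v) z

/-- The cell `[x, y]` of a ternary operation. -/
def cell (m : X → X → X → X) (x y : X) : Set X := {z | m x y z = z}

def IsConvex (m : X → X → X → X) (A : Set X) : Prop :=
  ∀ x ∈ A, ∀ y ∈ A, cell m x y ⊆ A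

/-- `A` is a retractible convex subset, and `ψ` is its associated map:
`[x, a] ∩ A = [ψ x, a]` for all `x` and all `a ∈ A`. -/
def IsRetractibleVia (m : X → X → X → X) (A : Set X) (ψ : X → X) : Prop :=
  A.Nonempty ∧ IsConvex m A ∧ Set.range ψ = A ∧
    ∀ x, ∀ a ∈ A, cell m x a ∩ A = cell m (ψ x) a

def IsFolding (m : X → X → X → X) (ψ : X → X) : Prop :=
  ∀ x y z, ψ (m x y z) = m (ψ x) y (ψ z)

def IsLocallyLinear (m : X → X → X → X) : Prop :=
  ∀ x y, ∀ z ∈ cell m x y, cell m x y = cell m x z ∪ cell m z y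

def IsSimplicial (m : X → X → X → X) : Prop :=
  ∀ x y, (cell m x y).Finite

/-- A median group operation: a median operation compatible with left multiplication. -/
def IsMedianGroupOp {G : Type*} [Group G] (m : G → G → G → G) : Prop :=
  IsMedian m ∧ ∀ u x y z, u * m x y z = m (u * x) (u * y) (u * z)

/-- The median operations on `X` compatible with the action of `H`. -/
def medianOps (H X : Type*) [Group H] [MulAction H X] : Set (X → X → X → X) :=
  {m | IsMedian m ∧ ∀ (h : H) (x y z : X), m (h • x) (h • y) (h • z) = h • m x y z}

end MedianSets

/-- A set of representatives for the `H`-orbits in `X`, with a distinguished representative,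
the base point. -/
structure OrbitReps (H X : Type*) [Group H] [MulAction H X] where
  reps : Set X
  base : X
  base_mem : base ∈ reps
  existsUnique_rep : ∀ x : X, ∃! b, b ∈ reps ∧ x ∈ MulAction.orbit H b

namespace OrbitReps

noncomputable section

variable {H X : Type*} [Group H] [MulAction H X] (R : OrbitReps H X)

/-- The representatives of the orbits other than the orbit of the base point. -/
abbrev NonBase : Type _ := {b : X // b ∈ R.reps ∧ b ≠ R.base}

/-- The free product of `H` and the free group on the non-base representatives. -/
abbrev Hat : Type _ := Monoid.Coprod H (FreeGroup R.NonBase)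

/-- The canonical homomorphism from `H` to the free product. -/
def incl : H →* R.Hat := Monoid.Coprod.inl

/-- The free generator attached to a non-base representative. -/
def gen (i : R.NonBase) : R.Hat := Monoid.Coprod.inr (FreeGroup.of i)

open Classical in
/-- The element of the free product attached to a representative `b`:
`1` for the base point and the free generator otherwise. -/
def letter (b : X) : R.Hat :=
  if hb : b ∈ R.reps ∧ b ≠ R.base then R.gen ⟨b, hb⟩ else 1

/-- The representative of the orbit of `x`. -/
def rep (x : X) : X := (R.existsUnique_rep x).choose

theorem exists_coeff (x : X) : ∃ h : H, h • R.rep x = x :=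
  (R.existsUnique_rep x).choose_spec.1.2

/-- An element of `H` (the only one, if the action is free) with `coeff x • rep x = x`. -/
def coeff (x : X) : H := (R.exists_coeff x).choose

/-- The map `h b ↦ h * b` from `X` to the free product (`h ∈ H`, `b` a representative). -/
def emb (x : X) : R.Hat := R.incl (R.coeff x) * R.letter (R.rep x)

/-- The alphabet: the nontrivial elements of `H`, the free generators and their inverses. -/
def alphabet : Set R.Hat :=
  {w | (∃ h : H, h ≠ 1 ∧ w = R.incl h) ∨ ∃ i : R.NonBase, w = R.gen i ∨ w = (R.gen i)⁻¹}

/-- The word length with respect to the alphabet. -/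
def length (w : R.Hat) : ℕ :=
  sInf {n | ∃ L : List R.Hat, (∀ a ∈ L, a ∈ R.alphabet) ∧ L.prod = w ∧ L.length = n}

/-- The tree order: `u ≤ v` iff `l(v) = l(u) + l(u⁻¹ v)`. -/
def TreeLE (u v : R.Hat) : Prop := R.length v = R.length u + R.length (u⁻¹ * v)

/-- `a` is the greatest lower bound of `u` and `v` for the tree order. -/
def IsTreeMeet (u v a : R.Hat) : Prop :=
  R.TreeLE a u ∧ R.TreeLE a v ∧ ∀ c, R.TreeLE c u → R.TreeLE c v → R.TreeLE c a

/-- The meet `u ∧ v` for the tree order. -/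
def treeMeet (u v : R.Hat) : R.Hat := Classical.epsilon (R.IsTreeMeet u v)

/-- `t` is the least upper bound of `u ∧ v`, `v ∧ w`, `w ∧ u` for the tree order. -/
def IsTreeMedian (u v w t : R.Hat) : Prop :=
  (R.TreeLE (R.treeMeet u v) t ∧ R.TreeLE (R.treeMeet v w) t ∧ R.TreeLE (R.treeMeet w u) t) ∧
    ∀ c, R.TreeLE (R.treeMeet u v) c → R.TreeLE (R.treeMeet v w) c → R.TreeLE (R.treeMeet w u) c →
      R.TreeLE t c

/-- The tree median `Y(u, v, w) = (u ∧ v) ∨ (v ∧ w) ∨ (w ∧ u)`. -/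
def treeMedian (u v w : R.Hat) : R.Hat := Classical.epsilon (R.IsTreeMedian u v w)

/-- `x` is the greatest element of `X` lying below `w` for the tree order. -/
def IsRetractOf (w : R.Hat) (x : X) : Prop :=
  R.TreeLE (R.emb x) w ∧ ∀ y : X, R.TreeLE (R.emb y) w → R.TreeLE (R.emb y) (R.emb x)

/-- The canonical retract: `φ(w)` is the greatest element of `X` lying below `w`. -/
def retract (w : R.Hat) : X := @Classical.epsilon X ⟨R.base⟩ (R.IsRetractOf w)

/-- The median group operations on the free product for which the canonical retract,
viewed as a self-map of the free product, is a folding. -/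
def medianGroupOps : Set (R.Hat → R.Hat → R.Hat → R.Hat) :=
  {M | IsMedianGroupOp M ∧ IsFolding M (fun w => R.emb (R.retract w))}

/-- Restriction to `X` of a ternary operation on the free product. For operations that preserve
`X` this is the restriction in the usual sense, since `φ` is a left inverse of the embedding. -/
def res (M : R.Hat → R.Hat → R.Hat → R.Hat) (x y z : X) : X :=
  R.retract (M (R.emb x) (R.emb y) (R.emb z))

/-- `(u, v, w) ↦ t m(φ(t⁻¹ u), φ(t⁻¹ v), φ(t⁻¹ w))` with `t = Y(u, v, w)`. -/
def ext (m : X → X → X → X) (u v w : R.Hat) : R.Hat :=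
  R.treeMedian u v w *
    R.emb (m (R.retract ((R.treeMedian u v w)⁻¹ * u))
             (R.retract ((R.treeMedian u v w)⁻¹ * v))
             (R.retract ((R.treeMedian u v w)⁻¹ * w)))

/-- The set `C_v` of the elements `w ≤ v` such that `φ(w⁻¹)` is a representative, and
`φ(w⁻¹ v) ≠ 1` if `φ(w⁻¹) = 1` (the element `1` of `X` is the base point). -/
def breakSet (v : R.Hat) : Set R.Hat :=
  {w | R.TreeLE w v ∧ R.retract w⁻¹ ∈ R.reps ∧
    (R.retract w⁻¹ = R.base → R.retract (w⁻¹ * v) ≠ R.base)}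

/-- `ζ(w) = w φ(w⁻¹)`. -/
def corner (w : R.Hat) : R.Hat := w * R.emb (R.retract w⁻¹)

/-- The sequence `ζ(w_0), …, ζ(w_n), v` of end points. -/
def ends {n : ℕ} (w : Fin (n + 1) → R.Hat) (v : R.Hat) : Fin (n + 2) → R.Hat :=
  Fin.snoc (α := fun _ => R.Hat) (fun i => R.corner (w i)) v

end

end OrbitReps

end FreeMedian

/-! The group `Ĥ` is covered by the translates of `ι(X)`, arranged in a tree-like fashion. A point
`u` has the coordinates `φ(g u)`, `g ∈ Ĥ`, its projections to these translates, and three facts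
about them carry the proof. They determine `u` (`eq_of_retract_mul_eq`). For `h ∈ H` one has `φ(h u)
= h φ(u)`. For `k ∉ H` the map `z ↦ φ(k z)` is constant on `ι(X)`, with value `φ(k)`
(`retract_mul_emb`), and it keeps this value at every `z` with `φ(z) ≠ φ(k⁻¹)`
(`retract_mul_of_retract_ne`).

Consequently `ext m` is simply `m` in every coordinate (`retract_mul_ext`). After translation by the
inverse of `t = Y(u, v, w)` the three points begin with pairwise different letters, so for `k ∉ H`
at least two of their coordinates equal `φ(k)`, and the majority value is the median. For `k ∈ H`
only equivariance is needed. The median axioms, left invariance and the folding property are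
equations and can be checked coordinatewise. Conversely an idempotent folding is a homomorphism, so
every `M` in `medianGroupOps` acts on each coordinate by its restriction; this gives uniqueness
(`ext_res`).

A cell consists of the points whose coordinates all lie in the corresponding cells of `X`. For the
cell `[1, v]`, the translates `w ι(X)` in which `1` and `v` have different projections are those
with `w` in `breakSet v`, and the cell is the union of the pieces inside them (`cell_ext_one`).
These `w` are prefixes of `v`, hence finite in number and linearly ordered, and each piece ends
where the next one starts (`ends_succ`). All computations rest on reduced words, for which the tree
order is the prefix order. -/

namespace FreeMedian

/-! ### Normal forms in the free product of `H` and a free group. -/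

namespace FreeProduct

set_option linter.unusedSectionVars false

variable {H α : Type*} [Group H]

/-- Letters of words in the free product of `H` and the free group on `α`. -/
abbrev Letter (H α : Type*) := H ⊕ (α × Bool)

/-- Two letters that may be neighbours in a reduced word. -/
def Compat : Letter H α → Letter H α → Prop
  | .inl _, .inl _ => False
  | .inr a, .inr b => a.1 = b.1 → a.2 = b.2
  | _, _ => True

@[simp] theorem compat_inl_inl (h k : H) :
    Compat (.inl h : Letter H α) (.inl k) ↔ False := Iff.rfl
@[simp] theorem compat_inl_inr (h : H) (c : α × Bool) :
    Compat (.inl h : Letter H α) (.inr c) ↔ True := Iff.rfl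
@[simp] theorem compat_inr_inl (h : H) (c : α × Bool) :
    Compat (.inr c : Letter H α) (.inl h) ↔ True := Iff.rfl
@[simp] theorem compat_inr_inr (c d : α × Bool) :
    Compat (.inr c : Letter H α) (.inr d) ↔ (c.1 = d.1 → c.2 = d.2) := Iff.rfl

/-- Reduced words: no trivial letters from `H`, and neighbours do not merge or cancel. -/
def Reduced (L : List (Letter H α)) : Prop := Sum.inl 1 ∉ L ∧ L.IsChain Compat

theorem reduced_nil : Reduced ([] : List (Letter H α)) := by simp [Reduced]

theorem reduced_cons {c : Letter H α} {L : List (Letter H α)} :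
    Reduced (c :: L) ↔ c ≠ .inl 1 ∧ (∀ d ∈ L.head?, Compat c d) ∧ Reduced L := by
  simp only [Reduced, List.mem_cons, not_or, List.isChain_cons, ne_eq, eq_comm (a := c)]
  tauto

theorem reduced_append {L M : List (Letter H α)} :
    Reduced (L ++ M) ↔ Reduced L ∧ Reduced M ∧
      ∀ c ∈ L.getLast?, ∀ d ∈ M.head?, Compat c d := by
  simp only [Reduced, List.mem_append, not_or, List.isChain_append]
  tauto

/-- The group element of a letter. -/
def letterVal : Letter H α → Monoid.Coprod H (FreeGroup α)
  | .inl h => Monoid.Coprod.inl h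
  | .inr (a, true) => Monoid.Coprod.inr (FreeGroup.of a)
  | .inr (a, false) => (Monoid.Coprod.inr (FreeGroup.of a))⁻¹

/-- The group element of a word. -/
def eval (L : List (Letter H α)) : Monoid.Coprod H (FreeGroup α) := (L.map letterVal).prod

@[simp] theorem eval_nil : eval ([] : List (Letter H α)) = 1 := rfl
@[simp] theorem eval_cons (c : Letter H α) (L : List (Letter H α)) :
    eval (c :: L) = letterVal c * eval L := by simp [eval]
@[simp] theorem eval_append (L M : List (Letter H α)) : eval (L ++ M) = eval L * eval M := by
  simp [eval]

/-- The inverse letter. -/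
def invLetter : Letter H α → Letter H α
  | .inl h => .inl h⁻¹
  | .inr (a, s) => .inr (a, !s)

@[simp] theorem letterVal_invLetter (c : Letter H α) :
    letterVal (invLetter c) = (letterVal c)⁻¹ := by
  rcases c with h | ⟨a, _ | _⟩ <;> simp [letterVal, invLetter]

theorem compat_invLetter {c d : Letter H α} (h : Compat c d) :
    Compat (invLetter d) (invLetter c) := by
  rcases c with c | ⟨a, s⟩ <;> rcases d with d | ⟨b, t⟩ <;> simp_all [invLetter]

/-- The inverse word. -/
def invWord (L : List (Letter H α)) : List (Letter H α) := (L.map invLetter).reverse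

@[simp] theorem invWord_nil : invWord ([] : List (Letter H α)) = [] := rfl
@[simp] theorem invWord_cons (c : Letter H α) (L : List (Letter H α)) :
    invWord (c :: L) = invWord L ++ [invLetter c] := by simp [invWord]
@[simp] theorem invWord_append (L M : List (Letter H α)) :
    invWord (L ++ M) = invWord M ++ invWord L := by simp [invWord]

@[simp] theorem eval_invWord (L : List (Letter H α)) : eval (invWord L) = (eval L)⁻¹ := by
  induction L with
  | nil => simp
  | cons c L ih => simp [ih]

theorem Reduced.invWord {L : List (Letter H α)} (hL : Reduced L) : Reduced (invWord L) := by
  constructor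
  · intro h
    simp only [FreeProduct.invWord, List.mem_reverse, List.mem_map] at h
    obtain ⟨c, hc, h⟩ := h
    rcases c with c | ⟨a, s⟩
    · simp only [invLetter, Sum.inl.injEq, inv_eq_one] at h
      subst h
      exact hL.1 hc
    · simp [invLetter] at h
  · rw [FreeProduct.invWord, List.isChain_reverse, List.isChain_map]
    exact hL.2.imp fun _ _ h => compat_invLetter h

open Classical in
/-- Left multiplication of a reduced word by a letter. -/
noncomputable def push : Letter H α → List (Letter H α) → List (Letter H α)
  | .inl h, .inl k :: L => if h * k = 1 then L else .inl (h * k) :: L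
  | .inl h, L => if h = 1 then L else .inl h :: L
  | .inr c, .inr d :: L => if c.1 = d.1 ∧ c.2 ≠ d.2 then L else .inr c :: .inr d :: L
  | .inr c, L => .inr c :: L

theorem Reduced.push {L : List (Letter H α)} (c : Letter H α) (hL : Reduced L) :
    Reduced (push c L) := by
  rcases c with h | c <;> rcases L with _ | ⟨k | d, L⟩ <;> simp only [FreeProduct.push] <;>
    (try split_ifs) <;> simp_all [reduced_cons, reduced_nil]

theorem length_push_le (c : Letter H α) (L : List (Letter H α)) :
    (push c L).length ≤ L.length + 1 := by
  rcases c with h | c <;> rcases L with _ | ⟨k | d, L⟩ <;> simp only [FreeProduct.push] <;>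
    (try split_ifs) <;> simp <;> omega

theorem eval_push (c : Letter H α) (L : List (Letter H α)) :
    eval (push c L) = letterVal c * eval L := by
  rcases c with h | ⟨a, s⟩ <;> rcases L with _ | ⟨k | ⟨b, t⟩, L⟩ <;>
    simp only [FreeProduct.push] <;> (try split_ifs with hif)
  all_goals try simp [letterVal]
  all_goals try simp [hif]
  · rw [← mul_assoc, ← map_mul, hif, map_one, one_mul]
  · rw [mul_assoc]
  · obtain ⟨rfl, hif⟩ := hif
    cases s <;> cases t <;> simp_all

theorem Reduced.push_eq_cons {c : Letter H α} {L : List (Letter H α)} (h : Reduced (c :: L)) :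
    FreeProduct.push c L = c :: L := by
  rcases c with h | ⟨a, s⟩ <;> rcases L with _ | ⟨k | ⟨b, t⟩, L⟩ <;>
    simp_all [FreeProduct.push, reduced_cons]

theorem push_inl_one {L : List (Letter H α)} (hL : Reduced L) : push (.inl 1) L = L := by
  rcases L with _ | ⟨k | ⟨b, t⟩, L⟩ <;> simp_all [FreeProduct.push, reduced_cons]

theorem push_inl_mul {L : List (Letter H α)} (hL : Reduced L) (h k : H) :
    push (.inl (h * k)) L = push (.inl h) (push (.inl k) L) := by
  rcases L with _ | ⟨j | ⟨b, t⟩, L⟩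
  · by_cases hk : k = 1
    · subst hk
      simp only [FreeProduct.push, if_true]
      rw [mul_one]
    · simp [FreeProduct.push, hk]
  · have hL' : ∀ d ∈ L.head?, Compat (Sum.inl j) d := (reduced_cons.1 hL).2.1
    by_cases hk : k * j = 1
    · have : h * k * j = h := by rw [mul_assoc, hk, mul_one]
      rcases L with _ | ⟨i | ⟨b, t⟩, L⟩
      · simp only [FreeProduct.push, hk, if_true]
        rw [this]
      · simp at hL'
      · simp only [FreeProduct.push, hk, if_true]
        rw [this]
    · simp only [FreeProduct.push, hk, if_false]
      rw [mul_assoc]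
  · by_cases hk : k = 1
    · subst hk
      simp only [FreeProduct.push, if_true]
      rw [mul_one]
    · simp [FreeProduct.push, hk]

/-- If the inner `push` cancels a letter, the rest of the reduced word cannot begin with the inverse
of that letter, so the outer `push` puts it back. -/
theorem push_inr_push {L : List (Letter H α)} (hL : Reduced L) (a : α) (s : Bool) :
    push (.inr (a, s)) (push (.inr (a, !s)) L) = L := by
  rcases L with _ | ⟨j | ⟨b, t⟩, L⟩
  · simp [FreeProduct.push]
  · simp [FreeProduct.push]
  · have hL' : ∀ d ∈ L.head?, Compat (Sum.inr (b, t)) d := (reduced_cons.1 hL).2.1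
    by_cases hb : a = b ∧ (!s) ≠ t
    · obtain ⟨rfl, hb⟩ := hb
      have : s = t := by cases s <;> cases t <;> simp_all
      subst this
      rcases L with _ | ⟨i | ⟨b, t⟩, L⟩ <;> simp_all [FreeProduct.push]
    · have : push (.inr (a, !s)) (.inr (b, t) :: L) = .inr (a, !s) :: .inr (b, t) :: L := by
        simp only [FreeProduct.push, if_neg hb]
      rw [this]
      simp [FreeProduct.push]

/-- The action of `H` on reduced words. -/
noncomputable def inlAct : H →* Equiv.Perm {L : List (Letter H α) // Reduced L} :=
  MonoidHom.toHomPerm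
    { toFun := fun h L => ⟨push (.inl h) L.1, L.2.push _⟩
      map_one' := by funext L; exact Subtype.ext (push_inl_one L.2)
      map_mul' := fun h k => by funext L; exact Subtype.ext (push_inl_mul L.2 h k) }

/-- The action of a free generator on reduced words. -/
noncomputable def genAct (a : α) : Equiv.Perm {L : List (Letter H α) // Reduced L} where
  toFun L := ⟨push (.inr (a, true)) L.1, L.2.push _⟩
  invFun L := ⟨push (.inr (a, false)) L.1, L.2.push _⟩
  left_inv L := Subtype.ext (push_inr_push L.2 a false)
  right_inv L := Subtype.ext (push_inr_push L.2 a true)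

/-- The action of the free product on reduced words. -/
noncomputable def act :
    Monoid.Coprod H (FreeGroup α) →* Equiv.Perm {L : List (Letter H α) // Reduced L} :=
  Monoid.Coprod.lift inlAct (FreeGroup.lift genAct)

theorem act_letterVal (c : Letter H α) (L : {L : List (Letter H α) // Reduced L}) :
    (act (letterVal c) L).1 = push c L.1 := by
  rcases c with h | ⟨a, _ | _⟩
  · simp only [act, letterVal, Monoid.Coprod.lift_apply_inl]
    rfl
  · simp only [act, letterVal, map_inv, Monoid.Coprod.lift_apply_inr, FreeGroup.lift_apply_of]
    rfl
  · simp only [act, letterVal, Monoid.Coprod.lift_apply_inr, FreeGroup.lift_apply_of]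
    rfl

/-- The reduced word of an element of the free product. -/
noncomputable def red (u : Monoid.Coprod H (FreeGroup α)) : List (Letter H α) :=
  (act u ⟨[], reduced_nil⟩).1

theorem reduced_red (u : Monoid.Coprod H (FreeGroup α)) : Reduced (red u) := (act u _).2

@[simp] theorem red_one : red (1 : Monoid.Coprod H (FreeGroup α)) = [] := by simp [red]

theorem red_letterVal_mul (c : Letter H α) (u : Monoid.Coprod H (FreeGroup α)) :
    red (letterVal c * u) = push c (red u) := by
  rw [red, map_mul, Equiv.Perm.mul_apply, act_letterVal, red]

theorem red_eval {L : List (Letter H α)} (hL : Reduced L) : red (eval L) = L := by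
  induction L with
  | nil => simp
  | cons c L ih => rw [eval_cons, red_letterVal_mul, ih (reduced_cons.1 hL).2.2, hL.push_eq_cons]

theorem length_red_eval_le (L : List (Letter H α)) : (red (eval L)).length ≤ L.length := by
  induction L with
  | nil => simp
  | cons c L ih =>
    rw [eval_cons, red_letterVal_mul, List.length_cons]
    exact (length_push_le _ _).trans (by omega)

theorem exists_eval (u : Monoid.Coprod H (FreeGroup α)) : ∃ L : List (Letter H α), eval L = u := by
  induction u using Monoid.Coprod.induction_on with
  | inl h => exact ⟨[.inl h], by simp [letterVal]⟩
  | inr f =>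
    induction f using FreeGroup.induction_on with
    | C1 => exact ⟨[], by simp⟩
    | of a => exact ⟨[.inr (a, true)], by simp [letterVal]⟩
    | inv_of a _ => exact ⟨[.inr (a, false)], by simp [letterVal]⟩
    | mul x y hx hy =>
      obtain ⟨L, hL⟩ := hx
      obtain ⟨M, hM⟩ := hy
      exact ⟨L ++ M, by simp [hL, hM]⟩
  | mul x y hx hy =>
    obtain ⟨L, hL⟩ := hx
    obtain ⟨M, hM⟩ := hy
    exact ⟨L ++ M, by simp [hL, hM]⟩

theorem exists_reduced_eval (L : List (Letter H α)) :
    ∃ M, Reduced M ∧ eval M = eval L := by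
  induction L with
  | nil => exact ⟨[], reduced_nil, rfl⟩
  | cons c L ih =>
    obtain ⟨M, hM, h⟩ := ih
    exact ⟨push c M, hM.push c, by rw [eval_push, eval_cons, h]⟩

@[simp] theorem eval_red (u : Monoid.Coprod H (FreeGroup α)) : eval (red u) = u := by
  obtain ⟨L, rfl⟩ := exists_eval u
  obtain ⟨M, hM, h⟩ := exists_reduced_eval L
  rw [← h, red_eval hM]

theorem red_injective : Function.Injective (red : Monoid.Coprod H (FreeGroup α) → _) :=
  Function.LeftInverse.injective eval_red

theorem red_eq_nil {u : Monoid.Coprod H (FreeGroup α)} : red u = [] ↔ u = 1 := by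
  rw [← red_one (H := H) (α := α), red_injective.eq_iff]

theorem red_inv (u : Monoid.Coprod H (FreeGroup α)) : red u⁻¹ = invWord (red u) := by
  conv_lhs => rw [← eval_red u, ← eval_invWord]
  exact red_eval (reduced_red u).invWord

theorem red_mul_of_reduced {u v : Monoid.Coprod H (FreeGroup α)} (h : Reduced (red u ++ red v)) :
    red (u * v) = red u ++ red v := by
  rw [← red_eval h, eval_append, eval_red, eval_red]

theorem exists_shorter {c d : Letter H α} (h : ¬ Compat c d) :
    ∃ L : List (Letter H α), L.length < 2 ∧ eval L = letterVal c * letterVal d := by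
  rcases c with c | ⟨a, s⟩ <;> rcases d with d | ⟨b, t⟩
  · exact ⟨[.inl (c * d)], by simp, by simp [letterVal]⟩
  · simp at h
  · simp at h
  · refine ⟨[], by simp, ?_⟩
    simp only [compat_inr_inr, Classical.not_imp] at h
    obtain ⟨rfl, h⟩ := h
    cases s <;> cases t <;> simp_all [letterVal]

/-- If the letters at the junction merge or cancel, replacing the two by at most one gives a word
for `u * v` that is too short. -/
theorem length_red_mul_eq_iff {u v : Monoid.Coprod H (FreeGroup α)} :
    (red (u * v)).length = (red u).length + (red v).length ↔ Reduced (red u ++ red v) := by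
  refine ⟨fun h => ?_, fun h => by rw [red_mul_of_reduced h, List.length_append]⟩
  refine reduced_append.2 ⟨reduced_red u, reduced_red v, fun c hc d hd => ?_⟩
  by_contra hcd
  obtain ⟨L, hL, he⟩ := exists_shorter hcd
  obtain ⟨A, hA⟩ := List.getLast?_eq_some_iff.1 hc
  obtain ⟨B, hB⟩ := List.head?_eq_some_iff.1 hd
  have : u * v = eval (A ++ L ++ B) := by
    rw [← eval_red u, ← eval_red v, hA, hB]
    simp [he, mul_assoc]
  have h2 := length_red_eval_le (A ++ L ++ B)
  rw [← this, h, hA, hB] at h2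
  simp at h2
  omega

theorem reduced_iff_prefix {u v : Monoid.Coprod H (FreeGroup α)} :
    Reduced (red u ++ red (u⁻¹ * v)) ↔ red u <+: red v := by
  constructor
  · intro h
    refine ⟨red (u⁻¹ * v), ?_⟩
    rw [← red_mul_of_reduced h, mul_inv_cancel_left]
  · rintro ⟨S, hS⟩
    have hr : Reduced (red u ++ S) := hS ▸ reduced_red v
    have : u⁻¹ * v = eval S := by
      rw [← eval_red v, ← hS, eval_append, eval_red, inv_mul_cancel_left]
    rw [this, red_eval (reduced_append.1 hr).2.1]
    exact hr

end FreeProduct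

end FreeMedian

namespace FreeMedian

namespace OrbitReps

open FreeProduct

variable {H X : Type*} [Group H] [MulAction H X] (R : OrbitReps H X)

/-! ### Word length, and the tree order as prefix order. -/

theorem incl_eq (h : H) : R.incl h = letterVal (.inl h) := rfl

theorem gen_eq (i : R.NonBase) : R.gen i = letterVal (.inr (i, true)) := rfl

theorem length_eq (w : R.Hat) : R.length w = (red w).length := by
  apply le_antisymm
  · refine Nat.sInf_le ⟨(red w).map letterVal, ?_, eval_red w, by simp⟩
    intro a ha
    obtain ⟨c, hc, rfl⟩ := List.mem_map.1 ha
    rcases c with h | ⟨i, _ | _⟩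
    · exact Or.inl ⟨h, fun h1 => (reduced_red w).1 (h1 ▸ hc), rfl⟩
    · exact Or.inr ⟨i, Or.inr rfl⟩
    · exact Or.inr ⟨i, Or.inl rfl⟩
  · refine le_csInf ⟨_, (red w).map letterVal, ?_, eval_red w, rfl⟩ ?_
    · intro a ha
      obtain ⟨c, hc, rfl⟩ := List.mem_map.1 ha
      rcases c with h | ⟨i, _ | _⟩
      · exact Or.inl ⟨h, fun h1 => (reduced_red w).1 (h1 ▸ hc), rfl⟩
      · exact Or.inr ⟨i, Or.inr rfl⟩
      · exact Or.inr ⟨i, Or.inl rfl⟩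
    · rintro n ⟨L, hL, rfl, rfl⟩
      have : ∃ M : List (Letter H R.NonBase), M.length = L.length ∧ eval M = L.prod := by
        induction L with
        | nil => exact ⟨[], rfl, rfl⟩
        | cons a L ih =>
          obtain ⟨M, hM, hv⟩ := ih fun b hb => hL b (List.mem_cons_of_mem _ hb)
          have : ∃ c : Letter H R.NonBase, letterVal c = a := by
            rcases hL a List.mem_cons_self with ⟨h, _, rfl⟩ | ⟨i, rfl | rfl⟩
            exacts [⟨.inl h, rfl⟩, ⟨.inr (i, true), rfl⟩, ⟨.inr (i, false), rfl⟩]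
          obtain ⟨c, rfl⟩ := this
          exact ⟨c :: M, by simp [hM], by simp [hv]⟩
      obtain ⟨M, hM, hv⟩ := this
      rw [← hv, ← hM]
      exact length_red_eval_le M

theorem treeLE_iff {u v : R.Hat} : R.TreeLE u v ↔ red u <+: red v := by
  rw [← reduced_iff_prefix, ← length_red_mul_eq_iff, TreeLE, length_eq, length_eq, length_eq,
    mul_inv_cancel_left]

theorem treeLE_refl (u : R.Hat) : R.TreeLE u u := R.treeLE_iff.2 List.prefix_rfl

theorem treeLE_antisymm {u v : R.Hat} (h : R.TreeLE u v) (h' : R.TreeLE v u) : u = v := by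
  rw [treeLE_iff] at h h'
  exact red_injective (h.eq_of_length (le_antisymm h.length_le h'.length_le))

theorem treeLE_trans {u v w : R.Hat} (h : R.TreeLE u v) (h' : R.TreeLE v w) : R.TreeLE u w := by
  rw [treeLE_iff] at *
  exact h.trans h'

theorem one_treeLE (u : R.Hat) : R.TreeLE 1 u := by
  rw [treeLE_iff, red_one]
  exact List.nil_prefix

theorem treeLE_total {u v w : R.Hat} (h : R.TreeLE u w) (h' : R.TreeLE v w) :
    R.TreeLE u v ∨ R.TreeLE v u := by
  simp only [treeLE_iff] at *
  exact List.prefix_or_prefix_of_prefix h h'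

theorem red_eval_of_prefix {Q : List (Letter H R.NonBase)} {v : R.Hat} (h : Q <+: red v) :
    red (eval Q) = Q := by
  obtain ⟨S, hS⟩ := h
  have := reduced_red v
  rw [← hS] at this
  exact red_eval (reduced_append.1 this).1

theorem red_inv_mul {u v : R.Hat} (h : R.TreeLE u v) : red v = red u ++ red (u⁻¹ * v) := by
  rw [treeLE_iff, ← reduced_iff_prefix] at h
  rw [← red_mul_of_reduced h, mul_inv_cancel_left]

theorem exists_longest_prefix {β : Type*} (L M : List β) :
    ∃ P, P <+: L ∧ P <+: M ∧ ∀ Q, Q <+: L → Q <+: M → Q <+: P := by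
  induction L generalizing M with
  | nil => exact ⟨[], List.nil_prefix, List.nil_prefix, fun Q h _ => h⟩
  | cons a L ih =>
    rcases M with _ | ⟨b, M⟩
    · exact ⟨[], List.nil_prefix, List.nil_prefix, fun Q _ h => h⟩
    · by_cases hab : a = b
      · subst hab
        obtain ⟨P, h1, h2, h3⟩ := ih M
        refine ⟨a :: P, List.cons_prefix_cons.2 ⟨rfl, h1⟩, List.cons_prefix_cons.2 ⟨rfl, h2⟩, ?_⟩
        intro Q hQ hQ'
        rcases Q with _ | ⟨c, Q⟩
        · exact List.nil_prefix
        · rw [List.cons_prefix_cons] at *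
          exact ⟨hQ.1, h3 Q hQ.2 hQ'.2⟩
      · refine ⟨[], List.nil_prefix, List.nil_prefix, fun Q hQ hQ' => ?_⟩
        rcases Q with _ | ⟨c, Q⟩
        · exact List.nil_prefix
        · rw [List.cons_prefix_cons] at *
          exact absurd (hQ.1.symm.trans hQ'.1) hab

/-! ### Meets and tree medians. -/

theorem isTreeMeet_treeMeet (u v : R.Hat) : R.IsTreeMeet u v (R.treeMeet u v) := by
  apply Classical.epsilon_spec (p := R.IsTreeMeet u v)
  obtain ⟨P, h1, h2, h3⟩ := exists_longest_prefix (red u) (red v)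
  have hP := R.red_eval_of_prefix h1
  refine ⟨eval P, ?_, ?_, ?_⟩
  · rwa [treeLE_iff, hP]
  · rwa [treeLE_iff, hP]
  · intro c hc hc'
    rw [treeLE_iff] at *
    rw [hP]
    exact h3 _ hc hc'

theorem treeMeet_eq {u v a : R.Hat} (h : R.IsTreeMeet u v a) : R.treeMeet u v = a :=
  R.treeLE_antisymm (h.2.2 _ (R.isTreeMeet_treeMeet u v).1 (R.isTreeMeet_treeMeet u v).2.1)
    ((R.isTreeMeet_treeMeet u v).2.2 _ h.1 h.2.1)

theorem treeMeet_eq_left {u v : R.Hat} (h : R.TreeLE u v) : R.treeMeet u v = u :=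
  R.treeMeet_eq ⟨R.treeLE_refl u, h, fun _ hc _ => hc⟩

theorem treeMeet_comm (u v : R.Hat) : R.treeMeet u v = R.treeMeet v u :=
  have h := R.isTreeMeet_treeMeet v u
  R.treeMeet_eq ⟨h.2.1, h.1, fun c h1 h2 => h.2.2 c h2 h1⟩

/-- Any two of the three meets lie below a common point and are therefore comparable, so the join is
the largest of them. -/
theorem isTreeMedian_and_mem (u v w : R.Hat) : R.IsTreeMedian u v w (R.treeMedian u v w) ∧
    (R.treeMedian u v w = R.treeMeet u v ∨ R.treeMedian u v w = R.treeMeet v w ∨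
      R.treeMedian u v w = R.treeMeet w u) := by
  have h1 := R.isTreeMeet_treeMeet u v
  have h2 := R.isTreeMeet_treeMeet v w
  have h3 := R.isTreeMeet_treeMeet w u
  have key : ∃ t, R.IsTreeMedian u v w t ∧
      (t = R.treeMeet u v ∨ t = R.treeMeet v w ∨ t = R.treeMeet w u) := by
    have c12 := R.treeLE_total h1.2.1 h2.1
    have c23 := R.treeLE_total h2.2.1 h3.1
    have c31 := R.treeLE_total h3.2.1 h1.1
    have mk1 : R.TreeLE (R.treeMeet v w) (R.treeMeet u v) →
        R.TreeLE (R.treeMeet w u) (R.treeMeet u v) → R.IsTreeMedian u v w (R.treeMeet u v) :=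
      fun a b => ⟨⟨R.treeLE_refl _, a, b⟩, fun _ h _ _ => h⟩
    have mk2 : R.TreeLE (R.treeMeet u v) (R.treeMeet v w) →
        R.TreeLE (R.treeMeet w u) (R.treeMeet v w) → R.IsTreeMedian u v w (R.treeMeet v w) :=
      fun a b => ⟨⟨a, R.treeLE_refl _, b⟩, fun _ _ h _ => h⟩
    have mk3 : R.TreeLE (R.treeMeet u v) (R.treeMeet w u) →
        R.TreeLE (R.treeMeet v w) (R.treeMeet w u) → R.IsTreeMedian u v w (R.treeMeet w u) :=
      fun a b => ⟨⟨a, b, R.treeLE_refl _⟩, fun _ _ _ h => h⟩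
    rcases c12 with c | c
    · rcases c23 with d | d
      · exact ⟨_, mk3 (R.treeLE_trans c d) d, by simp⟩
      · exact ⟨_, mk2 c d, by simp⟩
    · rcases c31 with d | d
      · exact ⟨_, mk1 c d, by simp⟩
      · exact ⟨_, mk3 d (R.treeLE_trans c d), by simp⟩
  obtain ⟨t, ht, hm⟩ := key
  have hs : R.IsTreeMedian u v w (R.treeMedian u v w) :=
    Classical.epsilon_spec (p := R.IsTreeMedian u v w) ⟨t, ht⟩
  have : R.treeMedian u v w = t :=
    R.treeLE_antisymm (hs.2 _ ht.1.1 ht.1.2.1 ht.1.2.2) (ht.2 _ hs.1.1 hs.1.2.1 hs.1.2.2)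
  rw [this]
  exact ⟨ht, hm⟩

theorem treeMedian_one (u v : R.Hat) : R.treeMedian u 1 v = R.treeMeet u v := by
  have h := (R.isTreeMedian_and_mem u 1 v).1
  have h1 : R.treeMeet u 1 = 1 := by rw [treeMeet_comm]; exact R.treeMeet_eq_left (R.one_treeLE _)
  have h2 : R.treeMeet 1 v = 1 := R.treeMeet_eq_left (R.one_treeLE _)
  rw [IsTreeMedian, h1, h2, R.treeMeet_comm v u] at h
  exact R.treeLE_antisymm (h.2 _ (R.one_treeLE _) (R.one_treeLE _) (R.treeLE_refl _)) h.1.2.2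

/-- Two elements whose reduced words do not begin with the same letter. -/
def Sep (a b : R.Hat) : Prop := ∀ c, (red a).head? = some c → (red b).head? ≠ some c

variable {R} in
theorem Sep.symm {a b : R.Hat} (h : R.Sep a b) : R.Sep b a := fun c hb ha => h c ha hb

/-- A common first letter `c` would give `t c ≤ u`. Since `t` followed by `c` is then reduced, also
`t c ≤ w`, so `t c` lies below the meet and hence below `t`. Only `u` is required to lie above `t`.
-/
theorem sep_of_meet_le {t u w : R.Hat} (htu : R.TreeLE t u)
    (h : R.TreeLE (R.treeMeet u w) t) : R.Sep (t⁻¹ * u) (t⁻¹ * w) := by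
  intro c hu hw
  have hred : Reduced (red t ++ red (t⁻¹ * w)) := by
    have := reduced_red u
    rw [R.red_inv_mul htu, reduced_append, hu] at this
    exact reduced_append.2 ⟨this.1, reduced_red _, by rw [hw]; exact this.2.2⟩
  have hw' := red_mul_of_reduced hred
  rw [mul_inv_cancel_left] at hw'
  obtain ⟨A, hA⟩ := List.head?_eq_some_iff.1 hu
  obtain ⟨B, hB⟩ := List.head?_eq_some_iff.1 hw
  have pu : red t ++ [c] <+: red u := ⟨A, by rw [R.red_inv_mul htu, hA]; simp⟩
  have pw : red t ++ [c] <+: red w := ⟨B, by rw [hw', hB]; simp⟩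
  have hr := R.red_eval_of_prefix pu
  have := R.treeLE_trans ((R.isTreeMeet_treeMeet u w).2.2 (eval (red t ++ [c]))
    (R.treeLE_iff.2 (hr.symm ▸ pu)) (R.treeLE_iff.2 (hr.symm ▸ pw))) h
  rw [treeLE_iff, hr] at this
  simpa using this.length_le

theorem sep_treeMedian (u v w : R.Hat) :
    R.Sep ((R.treeMedian u v w)⁻¹ * u) ((R.treeMedian u v w)⁻¹ * v) ∧
    R.Sep ((R.treeMedian u v w)⁻¹ * v) ((R.treeMedian u v w)⁻¹ * w) ∧
    R.Sep ((R.treeMedian u v w)⁻¹ * w) ((R.treeMedian u v w)⁻¹ * u) := by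
  obtain ⟨⟨⟨h1, h2, h3⟩, -⟩, hm⟩ := R.isTreeMedian_and_mem u v w
  have m1 := R.isTreeMeet_treeMeet u v
  have m2 := R.isTreeMeet_treeMeet v w
  have m3 := R.isTreeMeet_treeMeet w u
  generalize R.treeMedian u v w = t at *
  have h1' : R.TreeLE (R.treeMeet v u) t := by rwa [treeMeet_comm]
  have h2' : R.TreeLE (R.treeMeet w v) t := by rwa [treeMeet_comm]
  have h3' : R.TreeLE (R.treeMeet u w) t := by rwa [treeMeet_comm]
  -- As `t` is one of the meets, it lies below two of the three points, so each pair contains a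
  -- point above `t`.
  rcases hm with hm | hm | hm
  · have hu : R.TreeLE t u := hm ▸ m1.1
    have hv : R.TreeLE t v := hm ▸ m1.2.1
    exact ⟨R.sep_of_meet_le hu h1, R.sep_of_meet_le hv h2, (R.sep_of_meet_le hu h3').symm⟩
  · have hv : R.TreeLE t v := hm ▸ m2.1
    have hw : R.TreeLE t w := hm ▸ m2.2.1
    exact ⟨(R.sep_of_meet_le hv h1').symm, R.sep_of_meet_le hv h2, R.sep_of_meet_le hw h3⟩
  · have hw : R.TreeLE t w := hm ▸ m3.1
    have hu : R.TreeLE t u := hm ▸ m3.2.1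
    exact ⟨R.sep_of_meet_le hu h1, (R.sep_of_meet_le hw h2').symm, R.sep_of_meet_le hw h3⟩

/-! ### The retraction on reduced words. -/

/-- The word of an element of `H`. -/
noncomputable def inclWord (h : H) : List (Letter H R.NonBase) :=
  open Classical in if h = 1 then [] else [.inl h]

/-- The word of a representative. -/
noncomputable def repWord (b : X) : List (Letter H R.NonBase) :=
  open Classical in if hb : b ∈ R.reps ∧ b ≠ R.base then [.inr (⟨b, hb⟩, true)] else []

/-- Words that do not begin with a letter from `H`. -/
def FreeHead (T : List (Letter H R.NonBase)) : Prop := ∀ k, T.head? ≠ some (.inl k)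

/-- The retraction to `X` in terms of reduced words. -/
def retractWord : List (Letter H R.NonBase) → X
  | .inl h :: .inr (b, true) :: _ => h • b.1
  | .inl h :: _ => h • R.base
  | .inr (b, true) :: _ => b.1
  | _ => R.base

@[simp] theorem eval_inclWord (h : H) : eval (R.inclWord h) = R.incl h := by
  by_cases hh : h = 1 <;> simp [inclWord, hh, incl_eq, letterVal]

@[simp] theorem eval_repWord (b : X) : eval (R.repWord b) = R.letter b := by
  by_cases hb : b ∈ R.reps ∧ b ≠ R.base <;> simp [repWord, hb, letter, gen_eq]

theorem freeHead_repWord (b : X) : R.FreeHead (R.repWord b) := by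
  by_cases hb : b ∈ R.reps ∧ b ≠ R.base <;> simp [repWord, hb, FreeHead]

theorem reduced_repWord (b : X) : Reduced (R.repWord b) := by
  by_cases hb : b ∈ R.reps ∧ b ≠ R.base <;> simp [repWord, hb, reduced_cons, reduced_nil]

theorem reduced_inclWord_append (h : H) {T : List (Letter H R.NonBase)} (hT : Reduced T)
    (hf : R.FreeHead T) : Reduced (R.inclWord h ++ T) := by
  by_cases hh : h = 1
  · simpa [inclWord, hh]
  · simp only [inclWord, hh, if_false, List.singleton_append, reduced_cons]
    refine ⟨by simp [hh], ?_, hT⟩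
    rintro (k | d) hd
    · exact absurd hd (hf k)
    · simp

theorem exists_eq_inclWord_append {L : List (Letter H R.NonBase)} (hL : Reduced L) :
    ∃ h T, L = R.inclWord h ++ T ∧ Reduced T ∧ R.FreeHead T := by
  rcases L with _ | ⟨h | c, L⟩
  · exact ⟨1, [], by simp [inclWord], reduced_nil, by simp [FreeHead]⟩
  · rw [reduced_cons] at hL
    refine ⟨h, L, ?_, hL.2.2, ?_⟩
    · have : h ≠ 1 := by simpa using hL.1
      simp [inclWord, this]
    · intro k hk
      simpa using hL.2.1 _ hk
  · exact ⟨1, .inr c :: L, by simp [inclWord], hL, by simp [FreeHead]⟩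

theorem retractWord_inclWord_append (h : H) {T : List (Letter H R.NonBase)}
    (hf : R.FreeHead T) : R.retractWord (R.inclWord h ++ T) = h • R.retractWord T := by
  by_cases hh : h = 1
  · simp [inclWord, hh]
  · simp only [inclWord, hh, if_false, List.singleton_append]
    rcases T with _ | ⟨k | ⟨b, _ | _⟩, T⟩
    · simp [retractWord]
    · exact absurd rfl (hf k)
    · simp [retractWord]
    · simp [retractWord]

theorem retractWord_mem_reps {T : List (Letter H R.NonBase)} (hf : R.FreeHead T) :
    R.retractWord T ∈ R.reps := by
  rcases T with _ | ⟨k | ⟨b, _ | _⟩, T⟩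
  · exact R.base_mem
  · exact absurd rfl (hf k)
  · exact R.base_mem
  · exact b.2.1

theorem retractWord_eq_of_head {T T' : List (Letter H R.NonBase)} (hf : R.FreeHead T)
    (h : T.head? = T'.head?) : R.retractWord T = R.retractWord T' := by
  rcases T with _ | ⟨k | ⟨b, _ | _⟩, T⟩ <;> rcases T' with _ | ⟨k' | ⟨b', _ | _⟩, T'⟩ <;>
    simp_all [retractWord, FreeHead]

theorem retractWord_repWord {b : X} (hb : b ∈ R.reps) : R.retractWord (R.repWord b) = b := by
  by_cases h : b = R.base <;> simp [repWord, hb, h, retractWord]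

/-- `retractWord` reads at most an initial letter from `H` and the next letter, so nothing behind a
free letter matters. -/
theorem retractWord_append_inr (M S : List (Letter H R.NonBase)) (c : R.NonBase × Bool) :
    R.retractWord (M ++ .inr c :: S) = R.retractWord (M ++ [.inr c]) := by
  obtain ⟨b, s⟩ := c
  rcases M with _ | ⟨k | ⟨b', _ | _⟩, _ | ⟨k' | ⟨b'', _ | _⟩, M⟩⟩ <;> cases s <;> simp [retractWord]

/-- To `retractWord`, an inverse generator looks like the end of the word. -/
theorem retractWord_append_inr_false (M S : List (Letter H R.NonBase)) (b : R.NonBase) :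
    R.retractWord (M ++ .inr (b, false) :: S) = R.retractWord M := by
  rcases M with _ | ⟨k | ⟨b', _ | _⟩, _ | ⟨k' | ⟨b'', _ | _⟩, M⟩⟩ <;> simp [retractWord]

theorem red_incl_mul_eval (h : H) {T : List (Letter H R.NonBase)} (hT : Reduced T)
    (hf : R.FreeHead T) : red (R.incl h * eval T) = R.inclWord h ++ T := by
  rw [← red_eval (R.reduced_inclWord_append h hT hf), eval_append, eval_inclWord]

theorem smul_rep_inj (hfree : ∀ (h : H) (x : X), h • x = x → h = 1) {h k : H} {b c : X} (hb : b ∈ R.reps) (hc : c ∈ R.reps)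
    (e : h • b = k • c) : h = k ∧ b = c := by
  have hbc : b = c := by
    obtain ⟨d, _, hd⟩ := R.existsUnique_rep (h • b)
    rw [hd b ⟨hb, h, rfl⟩, hd c ⟨hc, k, e.symm⟩]
  subst hbc
  refine ⟨?_, rfl⟩
  have := hfree (k⁻¹ * h) b (by rw [mul_smul, e, inv_smul_smul])
  exact (inv_mul_eq_one.1 this).symm

end OrbitReps

end FreeMedian

namespace FreeMedian

namespace OrbitReps

open FreeProduct

variable {H X : Type*} [Group H] [MulAction H X] (R : OrbitReps H X)

/-! ### The embedding `ι` and the retraction `φ`. -/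

theorem rep_mem (x : X) : R.rep x ∈ R.reps := (R.existsUnique_rep x).choose_spec.1.1

theorem coeff_smul_rep (x : X) : R.coeff x • R.rep x = x := (R.exists_coeff x).choose_spec

theorem exists_eq_smul (x : X) : ∃ (h : H) (b : X), b ∈ R.reps ∧ x = h • b :=
  ⟨R.coeff x, R.rep x, R.rep_mem x, (R.coeff_smul_rep x).symm⟩

@[simp] theorem letter_base : R.letter R.base = 1 := by simp [letter]

theorem emb_smul_rep (hfree : ∀ (h : H) (x : X), h • x = x → h = 1) (h : H) {b : X}
    (hb : b ∈ R.reps) : R.emb (h • b) = R.incl h * R.letter b := by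
  obtain ⟨h1, h2⟩ := R.smul_rep_inj hfree (R.rep_mem _) hb (R.coeff_smul_rep (h • b))
  rw [emb, h1, h2]

theorem emb_smul (hfree : ∀ (h : H) (x : X), h • x = x → h = 1) (h : H) (x : X) :
    R.emb (h • x) = R.incl h * R.emb x := by
  obtain ⟨k, b, hb, rfl⟩ := R.exists_eq_smul x
  rw [← mul_smul, R.emb_smul_rep hfree _ hb, R.emb_smul_rep hfree _ hb, map_mul, mul_assoc]

theorem emb_base (hfree : ∀ (h : H) (x : X), h • x = x → h = 1) : R.emb R.base = 1 := by
  have := R.emb_smul_rep hfree 1 R.base_mem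
  simpa using this

theorem red_emb (hfree : ∀ (h : H) (x : X), h • x = x → h = 1) (h : H) {b : X}
    (hb : b ∈ R.reps) : red (R.emb (h • b)) = R.inclWord h ++ R.repWord b := by
  rw [R.emb_smul_rep hfree h hb, ← eval_repWord,
    R.red_incl_mul_eval h (R.reduced_repWord b) (R.freeHead_repWord b)]

theorem emb_injective (hfree : ∀ (h : H) (x : X), h • x = x → h = 1) :
    Function.Injective R.emb := by
  intro x y hxy
  have key : ∀ z, R.retractWord (red (R.emb z)) = z := by
    intro z
    obtain ⟨k, b, hb, rfl⟩ := R.exists_eq_smul z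
    rw [R.red_emb hfree _ hb, R.retractWord_inclWord_append _ (R.freeHead_repWord b),
      R.retractWord_repWord hb]
  rw [← key x, hxy, key]

theorem repWord_retractWord_prefix {T : List (Letter H R.NonBase)} (hf : R.FreeHead T) :
    R.repWord (R.retractWord T) <+: T := by
  rcases T with _ | ⟨k | ⟨b, _ | _⟩, T⟩
  · simp [retractWord, repWord]
  · exact absurd rfl (hf k)
  · simp [retractWord, repWord]
  · have := b.2
    simp [retractWord, repWord, this]

theorem repWord_nonBase (b : R.NonBase) : R.repWord b.1 = [.inr (b, true)] := by
  simp [repWord, b.2]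

theorem prefix_retractWord {h k : H} {c : X} {T : List (Letter H R.NonBase)}
    (hf : R.FreeHead T) (hp : R.inclWord k ++ R.repWord c <+: R.inclWord h ++ T) :
    R.inclWord k ++ R.repWord c <+: R.inclWord h ++ R.repWord (R.retractWord T) := by
  have hbase : R.repWord R.base = [] := by simp [repWord]
  by_cases hc : c ∈ R.reps ∧ c ≠ R.base
  · have hw : R.repWord c = [.inr (⟨c, hc⟩, true)] := by simp [repWord, hc]
    rw [hw] at hp ⊢
    rcases T with _ | ⟨j | ⟨b, _ | _⟩, T⟩ <;> by_cases hh : h = 1 <;> by_cases hk : k = 1 <;>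
      simp_all [inclWord, retractWord, FreeHead, repWord_nonBase]
  · have hw : R.repWord c = [] := by simp [repWord, hc]
    rw [hw, List.append_nil] at hp ⊢
    by_cases hk : k = 1
    · simp [inclWord, hk]
    · rcases T with _ | ⟨j | ⟨b, _ | _⟩, T⟩ <;> by_cases hh : h = 1 <;>
        simp_all [inclWord, retractWord, FreeHead, repWord_nonBase]

theorem isRetractOf_retractWord (hfree : ∀ (h : H) (x : X), h • x = x → h = 1) (w : R.Hat) :
    R.IsRetractOf w (R.retractWord (red w)) := by
  obtain ⟨h, T, hw, hT, hf⟩ := R.exists_eq_inclWord_append (reduced_red w)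
  have hx : red (R.emb (R.retractWord (red w))) =
      R.inclWord h ++ R.repWord (R.retractWord T) := by
    rw [hw, R.retractWord_inclWord_append h hf, R.red_emb hfree h (R.retractWord_mem_reps hf)]
  refine ⟨?_, fun y hy => ?_⟩
  · rw [treeLE_iff, hx, hw]
    exact List.prefix_append_right_inj _ |>.2 (R.repWord_retractWord_prefix hf)
  · obtain ⟨k, c, hc, rfl⟩ := R.exists_eq_smul y
    rw [treeLE_iff, hw, R.red_emb hfree k hc] at hy
    rw [treeLE_iff, hx, R.red_emb hfree k hc]
    exact R.prefix_retractWord hf hy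

theorem retract_eq (hfree : ∀ (h : H) (x : X), h • x = x → h = 1) (w : R.Hat) :
    R.retract w = R.retractWord (red w) := by
  have h := R.isRetractOf_retractWord hfree w
  have h' : R.IsRetractOf w (R.retract w) :=
    @Classical.epsilon_spec_aux X ⟨R.base⟩ (R.IsRetractOf w) ⟨_, h⟩
  exact R.emb_injective hfree (R.treeLE_antisymm (h.2 _ h'.1) (h'.2 _ h.1))

theorem isRetractOf_retract (hfree : ∀ (h : H) (x : X), h • x = x → h = 1) (w : R.Hat) :
    R.IsRetractOf w (R.retract w) := by
  rw [R.retract_eq hfree]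
  exact R.isRetractOf_retractWord hfree w

theorem retract_emb (hfree : ∀ (h : H) (x : X), h • x = x → h = 1) (x : X) :
    R.retract (R.emb x) = x := by
  obtain ⟨k, b, hb, rfl⟩ := R.exists_eq_smul x
  rw [R.retract_eq hfree, R.red_emb hfree _ hb,
    R.retractWord_inclWord_append _ (R.freeHead_repWord b), R.retractWord_repWord hb]

theorem retract_one (hfree : ∀ (h : H) (x : X), h • x = x → h = 1) :
    R.retract 1 = R.base := by
  rw [← R.emb_base hfree, R.retract_emb hfree]

theorem exists_eq_incl_mul (u : R.Hat) : ∃ h T, u = R.incl h * eval T ∧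
    red u = R.inclWord h ++ T ∧ Reduced T ∧ R.FreeHead T := by
  obtain ⟨h, T, hw, hT, hf⟩ := R.exists_eq_inclWord_append (reduced_red u)
  exact ⟨h, T, by rw [← eval_red u, hw, eval_append, eval_inclWord], hw, hT, hf⟩

theorem retract_incl_mul_eval (hfree : ∀ (h : H) (x : X), h • x = x → h = 1) (h : H)
    {T : List (Letter H R.NonBase)} (hT : Reduced T) (hf : R.FreeHead T) :
    R.retract (R.incl h * eval T) = h • R.retractWord T := by
  rw [R.retract_eq hfree, R.red_incl_mul_eval h hT hf, R.retractWord_inclWord_append h hf]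

theorem retract_incl_mul (hfree : ∀ (h : H) (x : X), h • x = x → h = 1) (h : H) (u : R.Hat) :
    R.retract (R.incl h * u) = h • R.retract u := by
  obtain ⟨k, T, rfl, -, hT, hf⟩ := R.exists_eq_incl_mul u
  rw [← mul_assoc, ← map_mul, R.retract_incl_mul_eval hfree _ hT hf,
    R.retract_incl_mul_eval hfree _ hT hf, mul_smul]

theorem incl_injective (hfree : ∀ (h : H) (x : X), h • x = x → h = 1) :
    Function.Injective R.incl := by
  intro h k e
  have h1 : R.retract (R.incl h * 1) = R.retract (R.incl k * 1) := by rw [e]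
  rw [R.retract_incl_mul hfree, R.retract_incl_mul hfree] at h1
  exact (inv_mul_eq_one.1 (hfree (k⁻¹ * h) (R.retract 1)
    (by rw [mul_smul, h1, inv_smul_smul]))).symm

theorem emb_image_orbit_base (hfree : ∀ (h : H) (x : X), h • x = x → h = 1) :
    R.emb '' MulAction.orbit H R.base = Set.range R.incl := by
  ext u
  constructor
  · rintro ⟨_, ⟨h, rfl⟩, rfl⟩
    exact ⟨h, by simp [R.emb_smul hfree, R.emb_base hfree]⟩
  · rintro ⟨h, rfl⟩
    exact ⟨h • R.base, ⟨h, rfl⟩, by simp [R.emb_smul hfree, R.emb_base hfree]⟩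

theorem closure_range_emb (hfree : ∀ (h : H) (x : X), h • x = x → h = 1) :
    Subgroup.closure (Set.range R.emb) = ⊤ := by
  have hl : ∀ c : Letter H R.NonBase, letterVal c ∈ Subgroup.closure (Set.range R.emb) := by
    have hg : ∀ i : R.NonBase, R.gen i ∈ Subgroup.closure (Set.range R.emb) := by
      intro i
      refine Subgroup.subset_closure ⟨i.1, ?_⟩
      have := R.emb_smul_rep hfree 1 i.2.1
      rw [one_smul, map_one, one_mul] at this
      rw [this, letter, dif_pos i.2]
    rintro (h | ⟨i, _ | _⟩)
    · refine Subgroup.subset_closure ⟨h • R.base, ?_⟩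
      rw [R.emb_smul hfree, R.emb_base hfree, mul_one]
      rfl
    · exact inv_mem (hg i)
    · exact hg i
  rw [eq_top_iff]
  intro u _
  rw [← eval_red u]
  refine Subgroup.list_prod_mem _ fun x hx => ?_
  obtain ⟨c, _, rfl⟩ := List.mem_map.1 hx
  exact hl c

/-! ### Projections to the translates of `X`. -/

/-- If the words of `k⁻¹` and `z` begin differently, then `k z` projects to `X` like `k`. -/
theorem retract_mul_eq (hfree : ∀ (h : H) (x : X), h • x = x → h = 1) {k z : R.Hat} {h₁ h₂ : H}
    {c : R.NonBase × Bool} {T₁ T₂ : List (Letter H R.NonBase)}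
    (hk : red k⁻¹ = R.inclWord h₁ ++ .inr c :: T₁) (hz : red z = R.inclWord h₂ ++ T₂)
    (hf : R.FreeHead T₂) (hne : h₁ = h₂ → T₂.head? ≠ some (.inr c)) :
    R.retract (k * z) = R.retract k := by
  -- Both `k z` and `k` have the form `(c T₁)⁻¹ h T` without cancellation, so the free letter `c⁻¹`
  -- survives and hides everything behind it. `key` is used for `k z` and, with `T` empty, for `k`.
  have key : ∀ (h : H) (T : List (Letter H R.NonBase)), Reduced T → R.FreeHead T →
      (h = 1 → T.head? ≠ some (.inr c)) →
      R.retract (eval (invWord (.inr c :: T₁)) * (R.incl h * eval T)) =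
        R.retractWord (invWord (.inr c :: T₁)) := by
    intro h T hT hfT hh
    have h1 : Reduced (invWord (.inr c :: T₁)) := by
      have := reduced_red k⁻¹
      rw [hk] at this
      exact (reduced_append.1 this).2.1.invWord
    have h2 : Reduced (invWord (.inr c :: T₁) ++ (R.inclWord h ++ T)) := by
      refine reduced_append.2 ⟨h1, R.reduced_inclWord_append h hT hfT, ?_⟩
      rcases c with ⟨b, s⟩
      intro d hd e he
      obtain rfl : Sum.inr (b, !s) = d := by simpa [invLetter] using hd
      rcases e with e | ⟨b', s'⟩
      · simp
      · by_cases h1 : h = 1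
        · have he' : T.head? = some (Sum.inr (b', s')) := by simpa [inclWord, h1] using he
          have := hh h1
          rw [he'] at this
          cases s <;> cases s' <;> simp_all <;> exact fun h => this h.symm
        · simp [inclWord, h1] at he
    rw [R.retract_eq hfree, ← eval_inclWord, ← eval_append, ← eval_append, red_eval h2]
    rcases c with ⟨b, s⟩
    simp only [invWord_cons, List.append_assoc, invLetter]
    exact R.retractWord_append_inr _ _ _
  have hk' : k = eval (invWord (.inr c :: T₁)) * R.incl h₁⁻¹ := by
    rw [← inv_inj, ← eval_red k⁻¹, hk]
    simp
  have hz' : z = R.incl h₂ * eval T₂ := by rw [← eval_red z, hz, eval_append, eval_inclWord]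
  have hT₂ : Reduced T₂ := by
    have := reduced_red z
    rw [hz] at this
    exact (reduced_append.1 this).2.1
  have e1 : k * z = eval (invWord (.inr c :: T₁)) * (R.incl (h₁⁻¹ * h₂) * eval T₂) := by
    rw [hk', hz']
    simp only [map_mul, mul_assoc]
  have e2 : k = eval (invWord (.inr c :: T₁)) * (R.incl h₁⁻¹ * eval []) := by
    rw [eval_nil, mul_one]
    exact hk'
  rw [e1, key _ _ hT₂ hf (fun h => hne (inv_mul_eq_one.1 h))]
  conv_rhs => rw [e2]
  rw [key _ _ reduced_nil (by simp [FreeHead]) (by simp)]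

theorem exists_red_inv_eq {k : R.Hat} (hk : k ∉ Set.range R.incl) :
    ∃ h c T, red k⁻¹ = R.inclWord h ++ .inr c :: T := by
  obtain ⟨h, T, e, hw, -, hf⟩ := R.exists_eq_incl_mul k⁻¹
  rcases T with _ | ⟨j | c, T⟩
  · refine absurd ⟨h⁻¹, ?_⟩ hk
    rw [map_inv, inv_eq_iff_eq_inv, e]
    simp
  · exact absurd rfl (hf j)
  · exact ⟨h, c, T, hw⟩

/-- The translate `k⁻¹ ι(X)` is seen from `ι(X)` through the single gate `φ(k⁻¹)`. If `k z`
cancelled into the last free letter of `k`, then `z` would start like `k⁻¹` and project to this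
gate. -/
theorem retract_mul_of_retract_ne (hfree : ∀ (h : H) (x : X), h • x = x → h = 1) {k z : R.Hat}
    (hk : k ∉ Set.range R.incl) (hne : R.retract z ≠ R.retract k⁻¹) :
    R.retract (k * z) = R.retract k := by
  obtain ⟨h₁, c, T₁, hw⟩ := R.exists_red_inv_eq hk
  obtain ⟨h₂, T₂, -, hz, -, hf⟩ := R.exists_eq_incl_mul z
  refine R.retract_mul_eq hfree hw hz hf fun h hT => hne ?_
  rw [R.retract_eq hfree, R.retract_eq hfree, hw, hz, R.retractWord_inclWord_append _ hf,
    R.retractWord_inclWord_append _ (by simp [FreeHead]), h,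
    R.retractWord_eq_of_head (T' := .inr c :: T₁) hf (by simp [hT])]

/-- Only a word that starts like `k⁻¹`, up to and including its first free letter, can change the
projection, and two separated words cannot both do so. -/
theorem retract_mul_of_sep (hfree : ∀ (h : H) (x : X), h • x = x → h = 1) {k z z' : R.Hat}
    (hk : k ∉ Set.range R.incl) (hs : R.Sep z z') :
    R.retract (k * z) = R.retract k ∨ R.retract (k * z') = R.retract k := by
  obtain ⟨h₁, c, T₁, hw⟩ := R.exists_red_inv_eq hk
  obtain ⟨h₂, T₂, -, hz, -, hf⟩ := R.exists_eq_incl_mul z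
  obtain ⟨h₃, T₃, -, hz', -, hf'⟩ := R.exists_eq_incl_mul z'
  by_cases h2 : h₁ = h₂ → T₂.head? ≠ some (.inr c)
  · exact Or.inl (R.retract_mul_eq hfree hw hz hf h2)
  by_cases h3 : h₁ = h₃ → T₃.head? ≠ some (.inr c)
  · exact Or.inr (R.retract_mul_eq hfree hw hz' hf' h3)
  push Not at h2 h3
  obtain ⟨rfl, h2⟩ := h2
  obtain ⟨rfl, h3⟩ := h3
  exfalso
  by_cases hh : h₁ = 1
  · exact hs (.inr c) (by simp [hz, inclWord, hh, h2]) (by simp [hz', inclWord, hh, h3])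
  · exact hs (.inl h₁) (by simp [hz, inclWord, hh]) (by simp [hz', inclWord, hh])

theorem retract_mul_emb (hfree : ∀ (h : H) (x : X), h • x = x → h = 1) {k : R.Hat}
    (hk : k ∉ Set.range R.incl) (x : X) : R.retract (k * R.emb x) = R.retract k := by
  obtain ⟨h₁, c, T₁, hw⟩ := R.exists_red_inv_eq hk
  obtain ⟨h, b, hb, rfl⟩ := R.exists_eq_smul x
  by_cases hne : h₁ = h → (R.repWord b).head? ≠ some (.inr c)
  · exact R.retract_mul_eq hfree hw (R.red_emb hfree h hb) (R.freeHead_repWord b) hne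
  push Not at hne
  obtain ⟨rfl, hne⟩ := hne
  -- In the remaining case `x` cancels the last free letter of `k`. That letter is an inverse
  -- generator, which `φ` ignores, so its loss does not change the projection.
  have hb' : R.repWord b = [.inr c] ∧ c.2 = true := by
    by_cases h : b = R.base
    · simp [repWord, h] at hne
    · simp only [repWord, hb, h, ne_eq, not_false_eq_true, and_self, dite_true, List.head?_cons,
        Option.some.injEq, Sum.inr.injEq] at hne ⊢
      simp [← hne]
  obtain ⟨hb', hc⟩ := hb'
  have hr : red k = invWord T₁ ++ .inr (c.1, false) :: invWord (R.inclWord h₁) := by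
    rw [← inv_inv k, red_inv, hw]
    obtain ⟨i, s⟩ := c
    obtain rfl : s = true := hc
    simp [invLetter]
  have hred : red (k * R.emb (h₁ • b)) = invWord T₁ := by
    have h1 : Reduced (invWord T₁) := by
      have := reduced_red k
      rw [hr] at this
      exact (reduced_append.1 this).1
    have hk' : k = (R.incl h₁ * (letterVal (.inr c) * eval T₁))⁻¹ := by
      rw [eq_inv_iff_mul_eq_one, ← eval_cons, ← eval_inclWord, ← eval_append, ← hw, eval_red,
        mul_inv_cancel]
    rw [← red_eval h1, R.emb_smul_rep hfree h₁ hb, ← eval_repWord, hb', hk', eval_invWord]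
    congr 1
    simp only [eval_cons, eval_nil]
    group
  rw [R.retract_eq hfree, R.retract_eq hfree, hred, hr, retractWord_append_inr_false]

/-- The projections to the translates of `X` separate the points. -/
theorem eq_of_retract_mul_eq (hfree : ∀ (h : H) (x : X), h • x = x → h = 1) {u v : R.Hat}
    (h : ∀ g, R.retract (g * u) = R.retract (g * v)) : u = v := by
  suffices ∀ x : R.Hat, (∀ g, R.retract g = R.retract (g * x)) → x = 1 by
    refine (inv_mul_eq_one.1 (this (u⁻¹ * v) fun g => ?_))
    rw [← mul_assoc, ← h, inv_mul_cancel_right]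
  clear h
  intro x hx
  rw [← red_eq_nil]
  by_contra hne
  have h1 := hx 1
  rw [one_mul, R.retract_one hfree] at h1
  obtain ⟨h, T, e, hw, hT, hf⟩ := R.exists_eq_incl_mul x
  rw [R.retract_eq hfree, hw, R.retractWord_inclWord_append h hf, ← one_smul H R.base] at h1
  obtain ⟨rfl, h2⟩ := R.smul_rep_inj hfree R.base_mem (R.retractWord_mem_reps hf) h1
  rw [hw] at hne
  rw [map_one, one_mul] at e
  rcases T with _ | ⟨k | ⟨b, _ | _⟩, T⟩
  · simp [inclWord] at hne
  · exact hf k rfl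
  -- The coordinate at `1` leaves only `x = 1` or a word starting with some `b⁻¹`. The coordinate at
  -- `b` then requires `b x` to start with `b`, which is impossible as `x` is reduced.
  · have h3 := hx (R.gen b)
    rw [reduced_cons] at hT
    have hb : R.retract (R.gen b) = b.1 := by
      rw [R.retract_eq hfree, gen_eq, ← mul_one (letterVal _), ← eval_nil, ← eval_cons,
        red_eval (by simp [reduced_cons, reduced_nil])]
      rfl
    have hbx : R.gen b * x = eval T := by
      rw [e, eval_cons, gen_eq, ← mul_assoc]
      simp [letterVal]
    rw [hb, hbx, R.retract_eq hfree, red_eval hT.2.2] at h3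
    obtain ⟨k, S, rfl, -, hS⟩ := R.exists_eq_inclWord_append hT.2.2
    rw [R.retractWord_inclWord_append k hS, ← one_smul H b.1] at h3
    obtain ⟨rfl, h4⟩ := R.smul_rep_inj hfree b.2.1 (R.retractWord_mem_reps hS) h3
    rcases S with _ | ⟨k | ⟨b', _ | _⟩, S⟩
    · exact b.2.2 h4
    · exact hS k rfl
    · exact b.2.2 h4
    · obtain rfl : b = b' := Subtype.ext h4
      simpa using hT.2.1 (.inr (b, true)) (by simp [inclWord])
  · exact b.2.2 h2.symm

end OrbitReps

end FreeMedian

namespace FreeMedian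

/-! ### Cells and foldings in median sets. -/

namespace IsMedian

variable {X : Type*} {m : X → X → X → X}

theorem self_left (hm : IsMedian m) (x y : X) : m x x y = x := by rw [hm.symm_right, hm.absorb]

theorem self_right (hm : IsMedian m) (x y : X) : m y x x = x := by rw [hm.symm_left, hm.absorb]

theorem left_mem_cell (hm : IsMedian m) (x y : X) : x ∈ cell m x y := hm.absorb x y

theorem right_mem_cell (hm : IsMedian m) (x y : X) : y ∈ cell m x y := hm.self_right y x

theorem cell_comm (hm : IsMedian m) (x y : X) : cell m x y = cell m y x := by
  ext z
  simp only [cell, Set.mem_ofPred_eq]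
  rw [hm.symm_left]

theorem eq_of_mem_cell_self (hm : IsMedian m) {x z : X} (h : z ∈ cell m x x) : z = x := by
  have h : m x x z = z := h
  rw [← h, hm.self_left]

theorem mem_cell (hm : IsMedian m) (x y z : X) : m x y z ∈ cell m x y := by
  change m x y (m x y z) = m x y z
  rw [hm.symm_right, hm.symm_left, hm.selfdistrib x y z x y, hm.self_left, hm.absorb]

theorem cell_subset_of_mem (hm : IsMedian m) {x y z : X} (hz : z ∈ cell m x y) : cell m x z ⊆ cell m x y := by
  intro p hp
  have hz : m x y z = z := hz
  have hp : m x z p = p := hp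
  change m x y p = p
  have h : m z x y = z := by rw [hm.symm_left, hm.symm_right, hz]
  calc m x y p = m (m x z p) x y := by rw [hp, hm.symm_left p x y, hm.symm_right x p y]
    _ = m x z p := by rw [hm.selfdistrib, hm.self_left, h]
    _ = p := hp

end IsMedian

/-- The image of a folding is retractible. -/
theorem IsFolding.isRetractibleVia {X : Type*} [Nonempty X] {m : X → X → X → X} {ψ : X → X}
    (hm : IsMedian m) (hψ : IsFolding m ψ) (hi : ∀ x, ψ (ψ x) = ψ x) :
    IsRetractibleVia m (Set.range ψ) ψ := by
  have hfix : ∀ x ∈ Set.range ψ, ψ x = x := by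
    rintro _ ⟨x, rfl⟩
    exact hi x
  have hconv : IsConvex m (Set.range ψ) := by
    intro x hx y hy z hz
    have hz : m x y z = z := hz
    refine ⟨z, ?_⟩
    conv_lhs => rw [← hz, hm.symm_right, hψ, hfix x hx, hfix y hy, hm.symm_right, hz]
  refine ⟨Set.range_nonempty ψ, hconv, rfl, fun x a ha => ?_⟩
  -- The point `m x a z` lies in the cell `[a, z]`, hence in the convex image, where `ψ` is the
  -- identity.
  have key : ∀ z ∈ Set.range ψ, m (ψ x) a z = m x a z := by
    intro z hz
    have h1 : m x a z ∈ Set.range ψ := by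
      refine hconv a ha z hz ?_
      rw [hm.symm_left, hm.symm_right]
      exact hm.mem_cell a z x
    rw [← hfix _ h1, hψ, hfix z hz]
  ext z
  constructor
  · rintro ⟨hz, hzr⟩
    exact (key z hzr).trans hz
  · intro hz
    have hzr := hconv (ψ x) ⟨x, rfl⟩ a ha hz
    exact ⟨(key z hzr).symm.trans hz, hzr⟩

/-- A folding that is a projection is a homomorphism. -/
theorem IsFolding.map_eq {X : Type*} {m : X → X → X → X} {ψ : X → X}
    (hm : IsMedian m) (hψ : IsFolding m ψ) (hi : ∀ x, ψ (ψ x) = ψ x) (x y z : X) :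
    ψ (m x y z) = m (ψ x) (ψ y) (ψ z) := by
  -- A folding acts on two arguments only; applying it a second time, after a transposition, reaches
  -- the third.
  rw [← hi, hψ, hm.symm_left, hψ, hi, hm.symm_left]

namespace OrbitReps

variable {H X : Type*} [Group H] [MulAction H X] (R : OrbitReps H X)

/-! ### Extending an operation from `X` to the free product. -/

section Extension

variable {m : X → X → X → X}

/-- In every translate of `X`, the operation `ext m` projects to `m`. -/
theorem retract_mul_ext (hfree : ∀ (h : H) (x : X), h • x = x → h = 1) (hm : m ∈ medianOps H X)
    (g u v w : R.Hat) : R.retract (g * R.ext m u v w) =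
      m (R.retract (g * u)) (R.retract (g * v)) (R.retract (g * w)) := by
  obtain ⟨s1, s2, s3⟩ := R.sep_treeMedian u v w
  simp only [ext]
  generalize R.treeMedian u v w = t at *
  have e : ∀ z, g * z = (g * t) * (t⁻¹ * z) := fun z => by group
  rw [e u, e v, e w, ← mul_assoc]
  generalize g * t = k
  generalize t⁻¹ * u = a at *
  generalize t⁻¹ * v = b at *
  generalize t⁻¹ * w = c at *
  by_cases hk : k ∈ Set.range R.incl
  · obtain ⟨h, rfl⟩ := hk
    simp only [R.retract_incl_mul hfree, R.retract_emb hfree, hm.2]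
  -- For `k ∉ H`, separation forces two of the three coordinates to be `φ(k)`, and `m` returns the
  -- repeated value.
  · rw [R.retract_mul_emb hfree hk]
    rcases R.retract_mul_of_sep hfree hk s1 with h1 | h1
    · rcases R.retract_mul_of_sep hfree hk s2 with h2 | h2
      · rw [h1, h2, hm.1.self_left]
      · rw [h1, h2, hm.1.absorb]
    · rcases R.retract_mul_of_sep hfree hk s3 with h2 | h2
      · rw [h1, h2, hm.1.self_right]
      · rw [h1, h2, hm.1.self_left]

theorem ext_mem_cell_iff (hfree : ∀ (h : H) (x : X), h • x = x → h = 1) (hm : m ∈ medianOps H X)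
    {u v z : R.Hat} : z ∈ cell (R.ext m) u v ↔
      ∀ g, R.retract (g * z) ∈ cell m (R.retract (g * u)) (R.retract (g * v)) := by
  constructor
  · intro h g
    have h : R.ext m u v z = z := h
    rw [cell, Set.mem_ofPred_eq, ← R.retract_mul_ext hfree hm, h]
  · intro h
    refine R.eq_of_retract_mul_eq hfree fun g => ?_
    rw [R.retract_mul_ext hfree hm]
    exact h g

theorem isMedian_ext (hfree : ∀ (h : H) (x : X), h • x = x → h = 1) (hm : m ∈ medianOps H X) :
    IsMedian (R.ext m) where
  symm_left x y z := R.eq_of_retract_mul_eq hfree fun g => by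
    simp only [R.retract_mul_ext hfree hm]
    exact hm.1.symm_left _ _ _
  symm_right x y z := R.eq_of_retract_mul_eq hfree fun g => by
    simp only [R.retract_mul_ext hfree hm]
    exact hm.1.symm_right _ _ _
  absorb x y := R.eq_of_retract_mul_eq hfree fun g => by
    simp only [R.retract_mul_ext hfree hm]
    exact hm.1.absorb _ _
  selfdistrib x y z u v := R.eq_of_retract_mul_eq hfree fun g => by
    simp only [R.retract_mul_ext hfree hm]
    exact hm.1.selfdistrib _ _ _ _ _

theorem mul_ext (hfree : ∀ (h : H) (x : X), h • x = x → h = 1) (hm : m ∈ medianOps H X)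
    (u x y z : R.Hat) : u * R.ext m x y z = R.ext m (u * x) (u * y) (u * z) :=
  R.eq_of_retract_mul_eq hfree fun g => by
    rw [← mul_assoc]
    simp only [R.retract_mul_ext hfree hm, ← mul_assoc]

theorem ext_emb (hfree : ∀ (h : H) (x : X), h • x = x → h = 1) (hm : m ∈ medianOps H X)
    (x y z : X) : R.ext m (R.emb x) (R.emb y) (R.emb z) = R.emb (m x y z) := by
  refine R.eq_of_retract_mul_eq hfree fun g => ?_
  rw [R.retract_mul_ext hfree hm]
  by_cases hg : g ∈ Set.range R.incl
  · obtain ⟨h, rfl⟩ := hg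
    simp only [R.retract_incl_mul hfree, R.retract_emb hfree, hm.2]
  · simp only [R.retract_mul_emb hfree hg, hm.1.self_left]

theorem isFolding_ext (hfree : ∀ (h : H) (x : X), h • x = x → h = 1) (hm : m ∈ medianOps H X) :
    IsFolding (R.ext m) fun w => R.emb (R.retract w) := by
  intro x y z
  refine R.eq_of_retract_mul_eq hfree fun g => ?_
  rw [R.retract_mul_ext hfree hm]
  by_cases hg : g ∈ Set.range R.incl
  · obtain ⟨h, rfl⟩ := hg
    have := R.retract_mul_ext hfree hm 1 x y z
    simp only [one_mul] at this
    simp only [R.retract_incl_mul hfree, R.retract_emb hfree, hm.2, this]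
  · simp only [R.retract_mul_emb hfree hg, hm.1.absorb]

theorem ext_mem_medianGroupOps (hfree : ∀ (h : H) (x : X), h • x = x → h = 1)
    (hm : m ∈ medianOps H X) : R.ext m ∈ R.medianGroupOps :=
  ⟨⟨R.isMedian_ext hfree hm, R.mul_ext hfree hm⟩, R.isFolding_ext hfree hm⟩

theorem res_ext (hfree : ∀ (h : H) (x : X), h • x = x → h = 1) (hm : m ∈ medianOps H X) :
    R.res (R.ext m) = m := by
  funext x y z
  rw [res, R.ext_emb hfree hm, R.retract_emb hfree]

/-- In every other translate all of `w ι(X)` has a single coordinate. As `p` and `q` project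
differently to `w ι(X)`, one of them misses the gate and shares this coordinate. -/
theorem mul_emb_mem_cell (hfree : ∀ (h : H) (x : X), h • x = x → h = 1) (hm : m ∈ medianOps H X)
    {w p q : R.Hat} {x : X} (hne : R.retract (w⁻¹ * p) ≠ R.retract (w⁻¹ * q))
    (hx : x ∈ cell m (R.retract (w⁻¹ * p)) (R.retract (w⁻¹ * q))) :
    w * R.emb x ∈ cell (R.ext m) p q := by
  rw [R.ext_mem_cell_iff hfree hm]
  intro g
  have e : ∀ z, g * z = (g * w) * (w⁻¹ * z) := fun z => by group
  rw [e p, e q, ← mul_assoc g w]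
  generalize g * w = k
  by_cases hk : k ∈ Set.range R.incl
  · obtain ⟨h, rfl⟩ := hk
    simp only [R.retract_incl_mul hfree, R.retract_emb hfree, cell, Set.mem_ofPred_eq, hm.2]
    exact congrArg _ hx
  · rw [R.retract_mul_emb hfree hk]
    by_cases hp : R.retract (w⁻¹ * p) = R.retract k⁻¹
    · rw [R.retract_mul_of_retract_ne hfree hk (z := w⁻¹ * q) fun h => hne (hp.trans h.symm)]
      exact hm.1.right_mem_cell _ _
    · rw [R.retract_mul_of_retract_ne hfree hk hp]
      exact hm.1.left_mem_cell _ _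

/-- Each coordinate of `p` lies in one of the two subcells, but the choice could depend on the
coordinate. Two coordinates excluding opposite subcells contradict each other, because the
projections to distinct translates are nearly independent of one another. -/
theorem isLocallyLinear_ext (hfree : ∀ (h : H) (x : X), h • x = x → h = 1)
    (hm : m ∈ medianOps H X) (hl : IsLocallyLinear m) : IsLocallyLinear (R.ext m) := by
  intro x y z hz
  have hM := R.isMedian_ext hfree hm
  apply Set.Subset.antisymm
  · intro p hp
    by_contra hn
    simp only [Set.mem_union, not_or] at hn
    obtain ⟨h1, h2⟩ := hn
    rw [R.ext_mem_cell_iff hfree hm] at h1 h2 hz hp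
    push Not at h1 h2
    obtain ⟨g, hg⟩ := h1
    obtain ⟨g', hg'⟩ := h2
    have key : ∀ f, R.retract (f * p) ∉ cell m (R.retract (f * x)) (R.retract (f * z)) →
        R.retract (f * p) ∈ cell m (R.retract (f * z)) (R.retract (f * y)) := by
      intro f hf
      have h := hl _ _ _ (hz f) ▸ hp f
      exact h.resolve_left hf
    have hpg := key g hg
    have hpg' : R.retract (g' * p) ∈ cell m (R.retract (g' * x)) (R.retract (g' * z)) := by
      by_contra h
      exact hg' (key g' h)
    by_cases hk : g * g'⁻¹ ∈ Set.range R.incl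
    · obtain ⟨h, hh⟩ := hk
      have e : ∀ q, g * q = R.incl h * (g' * q) := fun q => by rw [hh]; group
      rw [e p, e x, e z] at hg
      simp only [R.retract_incl_mul hfree, cell, Set.mem_ofPred_eq, hm.2] at hg
      exact hg (congrArg _ hpg')
    -- For distinct translates, every point has the gate value in at least one of the two
    -- coordinates. Since `p` differs from `x` and `z` at `g` and from `z` and `y` at `g'`, the gate
    -- values make two of these points coincide in a coordinate, and a cell shrinks to a point.
    · have alt : ∀ q, R.retract (g' * q) = R.retract (g * g'⁻¹)⁻¹ ∨
          R.retract (g * q) = R.retract (g * g'⁻¹) := by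
        intro q
        by_cases hq : R.retract (g' * q) = R.retract (g * g'⁻¹)⁻¹
        · exact Or.inl hq
        · right
          rw [← R.retract_mul_of_retract_ne hfree hk hq]
          congr 1
          group
      generalize R.retract (g * g'⁻¹)⁻¹ = c' at alt
      generalize R.retract (g * g'⁻¹) = c at alt
      have n1 : R.retract (g * p) ≠ R.retract (g * x) := fun h =>
        hg (h ▸ hm.1.left_mem_cell _ _)
      have n2 : R.retract (g * p) ≠ R.retract (g * z) := fun h =>
        hg (h ▸ hm.1.right_mem_cell _ _)
      have n3 : R.retract (g' * p) ≠ R.retract (g' * z) := fun h =>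
        hg' (h ▸ hm.1.left_mem_cell _ _)
      have n4 : R.retract (g' * p) ≠ R.retract (g' * y) := fun h =>
        hg' (h ▸ hm.1.right_mem_cell _ _)
      by_cases hc : R.retract (g * p) = c
      · have hx' := (alt x).resolve_right fun h => n1 (hc.trans h.symm)
        have hz' := (alt z).resolve_right fun h => n2 (hc.trans h.symm)
        rw [hx', ← hz'] at hpg'
        exact n3 (hm.1.eq_of_mem_cell_self hpg')
      · have hp' := (alt p).resolve_right hc
        have hz' := (alt z).resolve_left fun h => n3 (hp'.trans h.symm)
        have hy' := (alt y).resolve_left fun h => n4 (hp'.trans h.symm)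
        rw [hz', hy'] at hpg
        exact hc (hm.1.eq_of_mem_cell_self hpg)
  · refine Set.union_subset (hM.cell_subset_of_mem hz) ?_
    rw [hM.cell_comm z y, hM.cell_comm x y]
    rw [hM.cell_comm x y] at hz
    exact hM.cell_subset_of_mem hz

end Extension

/-! ### Restriction to `X`, uniqueness, and the induced order. -/

section Restriction

variable {M : R.Hat → R.Hat → R.Hat → R.Hat}

theorem emb_retract_idem (hfree : ∀ (h : H) (x : X), h • x = x → h = 1) (w : R.Hat) :
    R.emb (R.retract (R.emb (R.retract w))) = R.emb (R.retract w) := by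
  rw [R.retract_emb hfree]

theorem range_emb_retract (hfree : ∀ (h : H) (x : X), h • x = x → h = 1) :
    Set.range (fun w => R.emb (R.retract w)) = Set.range R.emb := by
  ext u
  constructor
  · rintro ⟨w, rfl⟩
    exact ⟨_, rfl⟩
  · rintro ⟨x, rfl⟩
    exact ⟨R.emb x, congrArg _ (R.retract_emb hfree x)⟩

theorem isRetractibleVia_range_emb (hfree : ∀ (h : H) (x : X), h • x = x → h = 1)
    (hM : M ∈ R.medianGroupOps) :
    IsRetractibleVia M (Set.range R.emb) fun w => R.emb (R.retract w) := by
  rw [← R.range_emb_retract hfree]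
  exact hM.2.isRetractibleVia hM.1.1 (R.emb_retract_idem hfree)

theorem emb_res (hfree : ∀ (h : H) (x : X), h • x = x → h = 1) (hM : M ∈ R.medianGroupOps)
    (x y z : X) : R.emb (R.res M x y z) = M (R.emb x) (R.emb y) (R.emb z) := by
  have := hM.2.map_eq hM.1.1 (R.emb_retract_idem hfree) (R.emb x) (R.emb y) (R.emb z)
  simp only [R.retract_emb hfree] at this
  exact this

theorem res_mem_medianOps (hfree : ∀ (h : H) (x : X), h • x = x → h = 1)
    (hM : M ∈ R.medianGroupOps) : R.res M ∈ medianOps H X := by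
  refine ⟨⟨?_, ?_, ?_, ?_⟩, ?_⟩ <;> intros <;> apply R.emb_injective hfree
  · simp only [R.emb_res hfree hM]
    exact hM.1.1.symm_left _ _ _
  · simp only [R.emb_res hfree hM]
    exact hM.1.1.symm_right _ _ _
  · simp only [R.emb_res hfree hM]
    exact hM.1.1.absorb _ _
  · simp only [R.emb_res hfree hM]
    exact hM.1.1.selfdistrib _ _ _ _ _
  · simp only [R.emb_res hfree hM, R.emb_smul hfree]
    exact (hM.1.2 _ _ _ _).symm

/-- The folding `ι ∘ φ` is a homomorphism for `M`, as are left translations, so `M` and the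
extension of its restriction have the same coordinates. -/
theorem ext_res (hfree : ∀ (h : H) (x : X), h • x = x → h = 1)
    (hM : M ∈ R.medianGroupOps) : R.ext (R.res M) = M := by
  funext u v w
  refine R.eq_of_retract_mul_eq hfree fun g => R.emb_injective hfree ?_
  rw [R.retract_mul_ext hfree (R.res_mem_medianOps hfree hM), R.emb_res hfree hM, hM.1.2]
  exact (hM.2.map_eq hM.1.1 (R.emb_retract_idem hfree) _ _ _).symm

theorem mem_cell_res (hfree : ∀ (h : H) (x : X), h • x = x → h = 1) (hM : M ∈ R.medianGroupOps)
    {x y z : X} : z ∈ cell (R.res M) x y ↔ R.emb z ∈ cell M (R.emb x) (R.emb y) := by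
  simp only [cell, Set.mem_ofPred_eq]
  rw [← R.emb_res hfree hM, (R.emb_injective hfree).eq_iff]

theorem isLocallyLinear_res (hfree : ∀ (h : H) (x : X), h • x = x → h = 1)
    (hM : M ∈ R.medianGroupOps) (hl : IsLocallyLinear M) : IsLocallyLinear (R.res M) := by
  intro x y z hz
  ext p
  rw [Set.mem_union]
  simp only [R.mem_cell_res hfree hM] at hz ⊢
  rw [hl _ _ _ hz, Set.mem_union]

theorem isSimplicial_res (hfree : ∀ (h : H) (x : X), h • x = x → h = 1)
    (hM : M ∈ R.medianGroupOps) (hs : IsSimplicial M) : IsSimplicial (R.res M) := by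
  intro x y
  refine ((hs (R.emb x) (R.emb y)).preimage (R.emb_injective hfree).injOn).subset fun z hz => ?_
  exact (R.mem_cell_res hfree hM).1 hz

/-- Translation by `w⁻¹` moves the end points into `ι(X)`, which is convex. -/
theorem cell_ext_mul_emb (hfree : ∀ (h : H) (x : X), h • x = x → h = 1) {m : X → X → X → X}
    (hm : m ∈ medianOps H X) (w : R.Hat) (x y : X) :
    cell (R.ext m) (w * R.emb x) (w * R.emb y) = (fun z => w * R.emb z) '' cell m x y := by
  have hM := R.ext_mem_medianGroupOps hfree hm
  ext p
  constructor
  · intro hp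
    have hp : R.ext m (w * R.emb x) (w * R.emb y) p = p := hp
    have hp' : w⁻¹ * p ∈ cell (R.ext m) (R.emb x) (R.emb y) := by
      change R.ext m _ _ _ = _
      conv_rhs => rw [← hp]
      rw [R.mul_ext hfree hm, inv_mul_cancel_left, inv_mul_cancel_left]
    obtain ⟨z, hz⟩ := (R.isRetractibleVia_range_emb hfree hM).2.1 _ ⟨x, rfl⟩ _ ⟨y, rfl⟩ hp'
    refine ⟨z, ?_, by simp [hz]⟩
    rw [← hz, ← R.mem_cell_res hfree hM, R.res_ext hfree hm] at hp'
    exact hp'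
  · rintro ⟨z, hz, rfl⟩
    have hz : m x y z = z := hz
    change R.ext m _ _ _ = _
    rw [← R.mul_ext hfree hm, R.ext_emb hfree hm, hz]

theorem ext_one (m : X → X → X → X) (u v : R.Hat) : R.ext m u 1 v =
    R.treeMeet u v * R.emb (m (R.retract ((R.treeMeet u v)⁻¹ * u))
      (R.retract (R.treeMeet u v)⁻¹) (R.retract ((R.treeMeet u v)⁻¹ * v))) := by
  rw [ext, treeMedian_one, mul_one]

theorem ext_one_eq_left_iff (hfree : ∀ (h : H) (x : X), h • x = x → h = 1) {m : X → X → X → X}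
    (hm : m ∈ medianOps H X) (u v : R.Hat) : R.ext m u 1 v = u ↔
      (R.treeMeet u v)⁻¹ * u ∈ R.emb '' cell m (R.retract (R.treeMeet u v)⁻¹)
        (R.retract ((R.treeMeet u v)⁻¹ * v)) := by
  rw [ext_one]
  generalize R.treeMeet u v = a
  constructor
  · intro h
    have h1 := (eq_inv_mul_of_mul_eq h).symm
    refine ⟨_, ?_, h1.symm⟩
    rw [hm.1.symm_left, hm.1.symm_right]
    exact hm.1.mem_cell _ _ _
  · rintro ⟨z, hz, e⟩
    have hz : m _ _ z = z := hz
    rw [← e, R.retract_emb hfree, hm.1.symm_left, hm.1.symm_right, hz, e, mul_inv_cancel_left]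

theorem ext_one_eq_left_of_treeLE (hfree : ∀ (h : H) (x : X), h • x = x → h = 1)
    {m : X → X → X → X} (hm : m ∈ medianOps H X) {u v : R.Hat} (huv : R.TreeLE u v)
    (hb : R.base ∈ cell m (R.retract u⁻¹) (R.retract (u⁻¹ * v))) : R.ext m u 1 v = u := by
  rw [R.ext_one_eq_left_iff hfree hm, R.treeMeet_eq_left huv]
  exact ⟨R.base, hb, by rw [R.emb_base hfree, inv_mul_cancel]⟩

theorem ext_one_eq_left_iff_mem_cell (hfree : ∀ (h : H) (x : X), h • x = x → h = 1)
    {m : X → X → X → X} (hm : m ∈ medianOps H X) {u v : R.Hat} :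
    R.ext m u 1 v = u ↔ u ∈ cell (R.ext m) 1 v := by
  have hM := R.isMedian_ext hfree hm
  rw [cell, Set.mem_ofPred_eq, hM.symm_left, hM.symm_right]

end Restriction

end OrbitReps

end FreeMedian

namespace FreeMedian

namespace OrbitReps

open FreeProduct

variable {H X : Type*} [Group H] [MulAction H X] (R : OrbitReps H X)

/-! ### The break set and the decomposition of the cells `[1, v]`. -/

theorem eq_one_of_smul_mem_reps (hfree : ∀ (h : H) (x : X), h • x = x → h = 1) {h : H} {b : X}
    (hb : b ∈ R.reps) (hhb : h • b ∈ R.reps) : h = 1 :=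
  (R.smul_rep_inj hfree hb hhb (one_smul H (h • b)).symm).1

theorem red_mul_of_treeLE {w v x : R.Hat} (hw : R.TreeLE w v) (hx : R.TreeLE x (w⁻¹ * v)) :
    red (w * x) = red w ++ red x := by
  apply red_mul_of_reduced
  rw [treeLE_iff] at hx
  obtain ⟨S, hS⟩ := hx
  have := reduced_red v
  rw [R.red_inv_mul hw, ← hS, ← List.append_assoc] at this
  exact (reduced_append.1 this).1

theorem treeLE_mul_of_treeLE {w v x : R.Hat} (hw : R.TreeLE w v) (hx : R.TreeLE x (w⁻¹ * v)) :
    R.TreeLE w (w * x) ∧ R.TreeLE (w * x) v := by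
  have h := R.red_mul_of_treeLE hw hx
  rw [treeLE_iff, treeLE_iff, h]
  refine ⟨List.prefix_append _ _, ?_⟩
  rw [R.red_inv_mul hw]
  exact (List.prefix_append_right_inj _).2 (R.treeLE_iff.1 hx)

theorem inv_mul_treeLE {s p v : R.Hat} (h : R.TreeLE s p) (h' : R.TreeLE p v) :
    R.TreeLE (s⁻¹ * p) (s⁻¹ * v) := by
  have h2 := R.red_inv_mul (R.treeLE_trans h h')
  rw [treeLE_iff, R.red_inv_mul h, h2, List.prefix_append_right_inj] at h'
  exact R.treeLE_iff.2 h'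

/-- The condition `φ(w⁻¹) ∈ B` says that the word of `w` does not end in a letter from `H`; it
selects one element `w` for each translate `w ι(X)`. -/
theorem exists_red_inv_of_retract_mem (hfree : ∀ (h : H) (x : X), h • x = x → h = 1) {w : R.Hat}
    (hw : R.retract w⁻¹ ∈ R.reps) :
    R.FreeHead (red w⁻¹) ∧ R.retract w⁻¹ = R.retractWord (red w⁻¹) := by
  obtain ⟨h, T, -, he, hT, hf⟩ := R.exists_eq_incl_mul w⁻¹
  have hr := R.retract_eq hfree w⁻¹
  rw [he, R.retractWord_inclWord_append h hf] at hr
  obtain rfl := R.eq_one_of_smul_mem_reps hfree (R.retractWord_mem_reps hf) (hr ▸ hw)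
  have : red w⁻¹ = T := by rw [he]; simp [inclWord]
  rw [this]
  exact ⟨hf, by rw [hr, one_smul]⟩

theorem letter_nonBase (b : R.NonBase) : R.letter b.1 = R.gen b := by
  rw [letter, dif_pos b.2]

theorem emb_nonBase (hfree : ∀ (h : H) (x : X), h • x = x → h = 1) (b : R.NonBase) :
    R.emb b.1 = R.gen b := by
  have := R.emb_smul_rep hfree 1 b.2.1
  rwa [one_smul, map_one, one_mul, letter_nonBase] at this

/-- Passing to the corner removes a final inverse generator from `w`, if there is one. -/
theorem corner_eq_or (hfree : ∀ (h : H) (x : X), h • x = x → h = 1) {w : R.Hat}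
    (hw : R.retract w⁻¹ ∈ R.reps) :
    R.corner w = w ∨ ∃ b, red w = red (R.corner w) ++ [.inr (b, false)] := by
  obtain ⟨hf, hr⟩ := R.exists_red_inv_of_retract_mem hfree hw
  rcases hT : red w⁻¹ with _ | ⟨k | ⟨b, _ | _⟩, T⟩ <;> rw [hT] at hr hf
  · left
    rw [corner, hr, retractWord, R.emb_base hfree, mul_one]
    all_goals simp
  · exact absurd rfl (hf k)
  · left
    rw [corner, hr, retractWord, R.emb_base hfree, mul_one]
    all_goals simp
  · right
    have hw' : red w = invWord T ++ [.inr (b, false)] := by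
      rw [← inv_inv w, red_inv, hT]
      simp [invLetter]
    have hp : invWord T <+: red w := hw' ▸ List.prefix_append _ _
    have hc : R.corner w = eval (invWord T) := by
      rw [corner, hr, ← eval_red w, hw']
      simp only [retractWord, R.emb_nonBase hfree, gen_eq]
      simp [letterVal]
    exact ⟨b, by rw [hc, R.red_eval_of_prefix hp, hw']⟩

theorem corner_treeLE (hfree : ∀ (h : H) (x : X), h • x = x → h = 1) {w : R.Hat}
    (hw : R.retract w⁻¹ ∈ R.reps) : R.TreeLE (R.corner w) w := by
  rcases R.corner_eq_or hfree hw with h | ⟨b, h⟩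
  · rw [h]
    exact R.treeLE_refl w
  · rw [treeLE_iff, h]
    exact List.prefix_append _ _

/-- The point at which the geodesic to `v` leaves the translate `w X`. -/
noncomputable def exit (v w : R.Hat) : R.Hat := w * R.emb (R.retract (w⁻¹ * v))

theorem treeLE_exit (hfree : ∀ (h : H) (x : X), h • x = x → h = 1) {v w : R.Hat}
    (hw : R.TreeLE w v) : R.TreeLE w (R.exit v w) ∧ R.TreeLE (R.exit v w) v :=
  R.treeLE_mul_of_treeLE hw (R.isRetractOf_retract hfree _).1

/-- Equal projections would make corner and exit coincide. As `w` lies between them, both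
projections would be the base point, which `breakSet` excludes. -/
theorem retract_inv_ne (hfree : ∀ (h : H) (x : X), h • x = x → h = 1) {v w : R.Hat}
    (hw : w ∈ R.breakSet v) : R.retract w⁻¹ ≠ R.retract (w⁻¹ * v) := by
  intro h
  have h1 := (R.treeLE_exit hfree hw.1).1
  rw [exit, ← h] at h1
  have h2 := R.treeLE_antisymm (R.corner_treeLE hfree hw.2.1) h1
  have h3 : R.emb (R.retract w⁻¹) = R.emb R.base := by
    rw [R.emb_base hfree]
    exact mul_eq_left.1 h2
  have h4 := R.emb_injective hfree h3
  exact hw.2.2 h4 (h ▸ h4)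

theorem corner_ne_exit (hfree : ∀ (h : H) (x : X), h • x = x → h = 1) {v w : R.Hat}
    (hw : w ∈ R.breakSet v) : R.corner w ≠ R.exit v w := fun h =>
  R.retract_inv_ne hfree hw (R.emb_injective hfree (mul_left_cancel h))

theorem inv_mul_notMem_range_incl (hfree : ∀ (h : H) (x : X), h • x = x → h = 1) {w w' : R.Hat}
    (hw : R.retract w⁻¹ ∈ R.reps) (hw' : R.retract w'⁻¹ ∈ R.reps) (hne : w ≠ w') :
    w⁻¹ * w' ∉ Set.range R.incl := by
  rintro ⟨h, hh⟩
  have e : w⁻¹ = R.incl h * w'⁻¹ := by rw [hh]; group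
  rw [e, R.retract_incl_mul hfree] at hw
  obtain rfl := R.eq_one_of_smul_mem_reps hfree hw' hw
  rw [map_one] at hh
  exact hne (inv_mul_eq_one.1 hh.symm)

theorem exists_red_inv_mul_eq (hfree : ∀ (h : H) (x : X), h • x = x → h = 1) {w w' : R.Hat}
    (hw' : R.retract w'⁻¹ ∈ R.reps) (hle : R.TreeLE w w') (hne : w ≠ w') :
    ∃ S c, red (w⁻¹ * w') = S ++ [.inr c] := by
  obtain ⟨hf, -⟩ := R.exists_red_inv_of_retract_mem hfree hw'
  have h := R.red_inv_mul hle
  rcases List.eq_nil_or_concat (red (w⁻¹ * w')) with h0 | ⟨S, d, hd⟩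
  · exact absurd (inv_mul_eq_one.1 (red_eq_nil.1 h0)) hne
  rcases d with k | c
  · rw [red_inv, h, hd] at hf
    exact absurd (by simp [invLetter]) (hf k⁻¹)
  · exact ⟨S, c, by simpa using hd⟩

/-- The word of `w⁻¹ w'` ends in a free letter, so continuing it to `w⁻¹ v` does not change the
projection. -/
theorem retract_inv_mul_eq (hfree : ∀ (h : H) (x : X), h • x = x → h = 1) {v w w' : R.Hat}
    (hw' : R.retract w'⁻¹ ∈ R.reps) (hle : R.TreeLE w w') (hle' : R.TreeLE w' v) (hne : w ≠ w') :
    R.retract (w⁻¹ * w') = R.retract (w⁻¹ * v) := by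
  obtain ⟨S, c, hS⟩ := R.exists_red_inv_mul_eq hfree hw' hle hne
  have h := R.red_inv_mul (R.inv_mul_treeLE hle hle')
  rw [R.retract_eq hfree, R.retract_eq hfree, h, hS, List.append_assoc, List.singleton_append]
  exact (R.retractWord_append_inr _ _ _).symm

theorem red_emb_ne_append (hfree : ∀ (h : H) (x : X), h • x = x → h = 1) (x : X)
    (S : List (Letter H R.NonBase)) (b : R.NonBase) : red (R.emb x) ≠ S ++ [.inr (b, false)] := by
  obtain ⟨h, c, hc, rfl⟩ := R.exists_eq_smul x
  rw [R.red_emb hfree h hc]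
  intro e
  have e := congrArg List.getLast? e
  by_cases h1 : h = 1 <;> by_cases h2 : c = R.base <;>
    simp [inclWord, repWord, h1, h2, hc] at e

theorem exit_treeLE_corner (hfree : ∀ (h : H) (x : X), h • x = x → h = 1) {v w w' : R.Hat}
    (hw' : R.retract w'⁻¹ ∈ R.reps) (hle : R.TreeLE w w') (hle' : R.TreeLE w' v) (hne : w ≠ w') :
    R.TreeLE (R.exit v w) (R.corner w') := by
  have hx := (R.treeLE_exit hfree hle).2
  have e : R.exit v w = R.exit w' w := by
    rw [exit, exit, R.retract_inv_mul_eq hfree hw' hle hle' hne]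
  rw [e]
  rcases R.corner_eq_or hfree hw' with h | ⟨b, h⟩
  · rwa [h]
  · have hx' := hx
    rw [treeLE_iff, h, List.prefix_concat_iff] at hx'
    rcases hx' with hx' | hx'
    -- The exit could only be `w'` itself if a word of `ι(X)` ended in an inverse generator.
    · exfalso
      rw [← h] at hx'
      have h3 := red_injective hx'
      obtain ⟨S, c, hS⟩ := R.exists_red_inv_mul_eq hfree hw' hle hne
      have h4 : w⁻¹ * w' = R.emb (R.retract (w⁻¹ * w')) :=
        (eq_inv_mul_of_mul_eq h3).symm
      have h5 := R.red_inv_mul hle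
      rw [h, hS, ← List.append_assoc] at h5
      have h6 := (List.append_inj' h5 rfl).2
      simp only [List.cons.injEq, Sum.inr.injEq, and_true] at h6
      subst h6
      rw [h4] at hS
      exact R.red_emb_ne_append hfree _ _ _ hS
    · exact R.treeLE_iff.2 hx'

theorem exists_red_eq_of_retract_eq_base (hfree : ∀ (h : H) (x : X), h • x = x → h = 1)
    {s : R.Hat} (hs : R.retract s = R.base) (h1 : s ≠ 1) :
    ∃ b T, red s = .inr (b, false) :: T := by
  obtain ⟨h, T, -, he, -, hf⟩ := R.exists_eq_incl_mul s
  rw [R.retract_eq hfree, he, R.retractWord_inclWord_append h hf] at hs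
  obtain ⟨rfl, hr⟩ := R.smul_rep_inj hfree (R.retractWord_mem_reps hf) R.base_mem
    (hs.trans (one_smul H R.base).symm)
  have he : red s = T := by rw [he]; simp [inclWord]
  rcases T with _ | ⟨k | ⟨b, _ | _⟩, T⟩
  · exact absurd (red_eq_nil.1 he) h1
  · exact absurd rfl (hf k)
  · exact ⟨b, T, he⟩
  · exact absurd hr b.2.2

/-- This is how the chain continues from `u`. If the rest of `v` starts with an inverse generator
`b⁻¹`, the next translate is that of `u b⁻¹`; otherwise it is that of `u`. -/
theorem exists_mem_breakSet_corner_eq (hfree : ∀ (h : H) (x : X), h • x = x → h = 1)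
    {u v : R.Hat} (hu : u = 1 ∨ ∃ w, R.TreeLE w v ∧ u = R.exit v w) (hne : u ≠ v) :
    ∃ w ∈ R.breakSet v, R.corner w = u := by
  have huv : R.TreeLE u v := by
    rcases hu with rfl | ⟨w, hw, rfl⟩
    · exact R.one_treeLE v
    · exact (R.treeLE_exit hfree hw).2
  have hred := R.red_inv_mul huv
  by_cases hb : R.retract (u⁻¹ * v) = R.base
  · obtain ⟨b, T, hT⟩ := R.exists_red_eq_of_retract_eq_base hfree hb
      (fun h => hne (inv_mul_eq_one.1 h))
    have hp : red u ++ [.inr (b, false)] <+: red v := ⟨T, by rw [hred, hT]; simp⟩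
    have hw : red (u * (R.gen b)⁻¹) = red u ++ [.inr (b, false)] := by
      rw [← R.red_eval_of_prefix hp]
      simp [letterVal, gen]
    have hr : R.retract (u * (R.gen b)⁻¹)⁻¹ = b.1 := by
      rw [R.retract_eq hfree, red_inv, hw]
      simp [invLetter, retractWord]
    refine ⟨u * (R.gen b)⁻¹, ⟨?_, ?_, ?_⟩, ?_⟩
    · rwa [treeLE_iff, hw]
    · rw [hr]
      exact b.2.1
    · rw [hr]
      exact fun h => absurd h b.2.2
    · rw [corner, hr, R.emb_nonBase hfree, inv_mul_cancel_right]
  · have hbase : R.retract u⁻¹ = R.base := by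
      rcases hu with rfl | ⟨w, hw, rfl⟩
      · rw [inv_one, R.retract_one hfree]
      · obtain ⟨h, b, hbr, he⟩ := R.exists_eq_smul (R.retract (w⁻¹ * v))
        -- An exit in `w H` would leave a rest of `v` projecting to the base point, contrary to the
        -- present case. Thus the exit ends in a generator and its inverse projects to the base
        -- point.
        by_cases hb' : b = R.base
        · subst hb'
          exfalso
          apply hb
          have e : (R.exit v w)⁻¹ * v = R.incl h⁻¹ * (w⁻¹ * v) := by
            rw [exit, he, R.emb_smul hfree, R.emb_base hfree, mul_one, map_inv]
            group
          rw [e, R.retract_incl_mul hfree, he, inv_smul_smul]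
        · have h1 : red (R.exit v w) = red w ++ (R.inclWord h ++ R.repWord b) := by
            rw [exit, R.red_mul_of_treeLE hw (R.isRetractOf_retract hfree _).1, he,
              R.red_emb hfree h hbr]
          rw [R.retract_eq hfree, red_inv, h1]
          simp [repWord, hbr, hb', invLetter, retractWord]
    refine ⟨u, ⟨huv, ?_, fun _ => hb⟩, ?_⟩
    · rw [hbase]
      exact R.base_mem
    · rw [corner, hbase, R.emb_base hfree, mul_one]

theorem exists_eq_mul_incl (hfree : ∀ (h : H) (x : X), h • x = x → h = 1) (t : R.Hat) :
    ∃ s h, t = s * R.incl h ∧ R.TreeLE s t ∧ R.retract s⁻¹ ∈ R.reps := by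
  obtain ⟨k, T, ht, he, hT, hf⟩ := R.exists_eq_incl_mul t⁻¹
  refine ⟨(eval T)⁻¹, k⁻¹, ?_, ?_, ?_⟩
  · rw [← inv_inv t, ht, mul_inv_rev, map_inv]
  · rw [treeLE_iff, ← inv_inv t, red_inv t⁻¹, he, red_inv, red_eval hT, invWord_append]
    exact List.prefix_append _ _
  · rw [inv_inv, R.retract_eq hfree, red_eval hT]
    exact R.retractWord_mem_reps hf

theorem exists_mem_breakSet_of_mem_cell (hfree : ∀ (h : H) (x : X), h • x = x → h = 1)
    {m : X → X → X → X} (hm : m ∈ medianOps H X) {v p : R.Hat} (hv : v ≠ 1)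
    (hp : p ∈ cell (R.ext m) 1 v) : ∃ w ∈ R.breakSet v, ∃ x, p = w * R.emb x := by
  have hcoord := (R.ext_mem_cell_iff hfree hm).1 hp
  have hpt := (R.ext_one_eq_left_iff_mem_cell hfree hm).2 hp
  rw [ext_one] at hpt
  obtain ⟨ht1, ht2, -⟩ := R.isTreeMeet_treeMeet p v
  generalize R.treeMeet p v = t at *
  -- The formula for `p ∩ v` places `p` in the translate of `t = p ∧ v`; `s` is its normalized
  -- representative.
  obtain ⟨s, h, rfl, hst, hs⟩ := R.exists_eq_mul_incl hfree t
  rw [mul_assoc, ← R.emb_smul hfree] at hpt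
  generalize h • m _ _ _ = x at hpt
  have hsv := R.treeLE_trans hst ht2
  by_cases hsC : s ∈ R.breakSet v
  · exact ⟨s, hsC, x, hpt.symm⟩
  have hb : R.retract s⁻¹ = R.base ∧ R.retract (s⁻¹ * v) = R.base := by
    by_contra hn
    exact hsC ⟨hsv, hs, fun h1 h2 => hn ⟨h1, h2⟩⟩
  have hx := hcoord s⁻¹
  rw [mul_one, hb.1, hb.2, ← hpt, inv_mul_cancel_left, R.retract_emb hfree] at hx
  have hx := hm.1.eq_of_mem_cell_self hx
  rw [hx, R.emb_base hfree, mul_one] at hpt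
  subst hpt
  -- Outside the break set both end points project to the base point, hence so does `p`, and `p =
  -- s`. This point must be found in another translate: at the initial corner if `s = 1`, and
  -- otherwise in the translate `q ι(X)` entered by deleting the last generator of `s`.
  by_cases h1 : s = 1
  · subst h1
    obtain ⟨w, hw, hc⟩ := R.exists_mem_breakSet_corner_eq hfree (Or.inl rfl) hv.symm
    exact ⟨w, hw, _, hc.symm⟩
  obtain ⟨b, T, hT⟩ := R.exists_red_eq_of_retract_eq_base hfree hb.1 (inv_ne_one.2 h1)
  have hsr : red s = invWord T ++ [.inr (b, true)] := by
    rw [← inv_inv s, red_inv s⁻¹, hT]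
    simp [invLetter]
  have hpre : invWord T <+: red s := hsr ▸ List.prefix_append _ _
  obtain ⟨q, k, hq, hqT, hqr⟩ := R.exists_eq_mul_incl hfree (eval (invWord T))
  have hsq : s = q * R.emb (k • b.1) := by
    rw [R.emb_smul hfree, ← mul_assoc, ← hq, R.emb_nonBase hfree]
    conv_lhs => rw [← eval_red s, hsr]
    simp [gen_eq]
  have hqs : R.TreeLE q s := by
    refine R.treeLE_trans hqT ?_
    rwa [treeLE_iff, R.red_eval_of_prefix hpre]
  refine ⟨q, ⟨R.treeLE_trans hqs hsv, hqr, fun _ h2 => ?_⟩, _, hsq⟩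
  have h3 := R.inv_mul_treeLE hqs hsv
  rw [hsq, inv_mul_cancel_left] at h3
  have h4 := (R.isRetractOf_retract hfree (q⁻¹ * v)).2 _ h3
  rw [h2, R.emb_base hfree] at h4
  have h5 := R.treeLE_antisymm h4 (R.one_treeLE _)
  rw [← R.emb_base hfree] at h5
  have h6 := R.emb_injective hfree h5
  exact b.2.2 (R.smul_rep_inj hfree b.2.1 R.base_mem (h6.trans (one_smul H R.base).symm)).2

theorem finite_setOf_treeLE (v : R.Hat) : {w | R.TreeLE w v}.Finite := by
  refine ((List.finite_toSet (red v).inits).image eval).subset fun w hw => ?_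
  exact ⟨red w, by simpa using R.treeLE_iff.1 hw, eval_red w⟩

theorem finite_breakSet (v : R.Hat) : (R.breakSet v).Finite :=
  (R.finite_setOf_treeLE v).subset fun _ hw => hw.1

theorem cell_ext_one (hfree : ∀ (h : H) (x : X), h • x = x → h = 1)
    {m : X → X → X → X} (hm : m ∈ medianOps H X) {v : R.Hat} (hv : v ≠ 1) :
    cell (R.ext m) 1 v = ⋃ w ∈ R.breakSet v,
      (fun x => w * R.emb x) '' cell m (R.retract w⁻¹) (R.retract (w⁻¹ * v)) := by
  ext p
  simp only [Set.mem_iUnion]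
  constructor
  · intro hp
    obtain ⟨w, hw, x, rfl⟩ := R.exists_mem_breakSet_of_mem_cell hfree hm hv hp
    refine ⟨w, hw, x, ?_, rfl⟩
    have := (R.ext_mem_cell_iff hfree hm).1 hp w⁻¹
    rwa [mul_one, inv_mul_cancel_left, R.retract_emb hfree] at this
  · rintro ⟨w, hw, x, hx, rfl⟩
    have hne := R.retract_inv_ne hfree hw
    rw [← congrArg R.retract (mul_one w⁻¹)] at hx hne
    exact R.mul_emb_mem_cell hfree hm hne hx

theorem isSimplicial_ext (hfree : ∀ (h : H) (x : X), h • x = x → h = 1)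
    {m : X → X → X → X} (hm : m ∈ medianOps H X) (hs : IsSimplicial m) :
    IsSimplicial (R.ext m) := by
  have hM := R.isMedian_ext hfree hm
  intro u v
  have h1 : (cell (R.ext m) 1 (u⁻¹ * v)).Finite := by
    by_cases huv : u⁻¹ * v = 1
    · rw [huv]
      exact (Set.finite_singleton 1).subset fun z hz => hM.eq_of_mem_cell_self hz
    · rw [R.cell_ext_one hfree hm huv]
      exact (R.finite_breakSet _).biUnion fun w _ => (hs _ _).image _
  refine (h1.image fun z => u * z).subset fun z hz => ⟨u⁻¹ * z, ?_, mul_inv_cancel_left _ _⟩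
  have hz : R.ext m u v z = z := hz
  have := R.mul_ext hfree hm u⁻¹ u v z
  rw [hz, inv_mul_cancel] at this
  exact this.symm

theorem exists_enum (v : R.Hat) (hne : (R.breakSet v).Nonempty) :
    ∃ (n : ℕ) (w : Fin (n + 1) → R.Hat), Set.range w = R.breakSet v ∧
      ∀ i j, i < j → R.TreeLE (w i) (w j) ∧ w i ≠ w j := by
  classical
  -- Elements below `v` are prefixes of its word, so the break set is indexed by their lengths.
  let S : Finset ℕ :=
    (Finset.range ((red v).length + 1)).filter fun k => eval ((red v).take k) ∈ R.breakSet v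
  have hred : ∀ k, red (eval ((red v).take k)) = (red v).take k := fun k =>
    R.red_eval_of_prefix (List.take_prefix _ _)
  have hS : ∀ w ∈ R.breakSet v, ∃ k ∈ S, eval ((red v).take k) = w := by
    intro w hw
    have hp := R.treeLE_iff.1 hw.1
    have e : eval ((red v).take (red w).length) = w := by
      rw [← List.prefix_iff_eq_take.1 hp, eval_red]
    refine ⟨(red w).length, ?_, e⟩
    rw [Finset.mem_filter, Finset.mem_range, e]
    exact ⟨Nat.lt_succ_of_le hp.length_le, hw⟩
  obtain ⟨w₀, hw₀⟩ := hne
  obtain ⟨k₀, hk₀, -⟩ := hS w₀ hw₀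
  obtain ⟨n, hn⟩ := Nat.exists_eq_succ_of_ne_zero (Finset.card_ne_zero_of_mem hk₀)
  refine ⟨n, fun i => eval ((red v).take (S.orderEmbOfFin hn i)), ?_, fun i j hij => ?_⟩
  · ext w
    constructor
    · rintro ⟨i, rfl⟩
      exact (Finset.mem_filter.1 (S.orderEmbOfFin_mem hn i)).2
    · intro hw
      obtain ⟨k, hk, rfl⟩ := hS w hw
      have : k ∈ Set.range (S.orderEmbOfFin hn) := by
        rw [Finset.range_orderEmbOfFin]
        exact hk
      obtain ⟨i, rfl⟩ := this
      exact ⟨i, rfl⟩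
  · have hlt : S.orderEmbOfFin hn i < S.orderEmbOfFin hn j := (S.orderEmbOfFin hn).strictMono hij
    have hj := Finset.mem_range.1 (Finset.mem_filter.1 (S.orderEmbOfFin_mem hn j)).1
    constructor
    · rw [treeLE_iff, hred, hred]
      exact List.take_prefix_take_left hlt.le
    · intro h
      have h := congrArg (fun u => (red u).length) h
      simp only [hred, List.length_take] at h
      omega

/-! ### Consecutive corners and exits. -/

section Enumeration

variable {n : ℕ} {v : R.Hat} {w : Fin (n + 1) → R.Hat}

theorem ends_castSucc (i : Fin (n + 1)) : R.ends w v i.castSucc = R.corner (w i) := by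
  rw [ends, Fin.snoc_castSucc]

theorem corner_treeLE_exit (hfree : ∀ (h : H) (x : X), h • x = x → h = 1) {v w : R.Hat}
    (hw : w ∈ R.breakSet v) : R.TreeLE (R.corner w) (R.exit v w) :=
  R.treeLE_trans (R.corner_treeLE hfree hw.2.1) (R.treeLE_exit hfree hw.1).1

theorem ends_zero (hfree : ∀ (h : H) (x : X), h • x = x → h = 1) (hv : v ≠ 1)
    (hr : Set.range w = R.breakSet v)
    (hlt : ∀ i j, i < j → R.TreeLE (w i) (w j) ∧ w i ≠ w j) : R.ends w v 0 = 1 := by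
  have hmem : ∀ i, w i ∈ R.breakSet v := fun i => hr ▸ ⟨i, rfl⟩
  obtain ⟨_, hw', hc⟩ := R.exists_mem_breakSet_corner_eq hfree (Or.inl rfl) hv.symm
  obtain ⟨j, rfl⟩ := hr ▸ hw'
  change R.ends w v (Fin.castSucc 0) = 1
  rw [ends_castSucc]
  rcases (Fin.zero_le j).eq_or_lt with rfl | hj
  · exact hc
  · have h1 := R.exit_treeLE_corner hfree (hmem j).2.1 (hlt 0 j hj).1 (hmem j).1 (hlt 0 j hj).2
    rw [hc] at h1
    exact R.treeLE_antisymm (R.treeLE_trans (R.corner_treeLE_exit hfree (hmem 0)) h1)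
      (R.one_treeLE _)

/-- The exit is the corner of some `w k`. For `k ≤ i`, monotonicity of corners and exits would force
the corner and the exit of `w k` to coincide. -/
theorem exists_lt_corner_eq_exit (hfree : ∀ (h : H) (x : X), h • x = x → h = 1)
    (hr : Set.range w = R.breakSet v)
    (hlt : ∀ i j, i < j → R.TreeLE (w i) (w j) ∧ w i ≠ w j) {i : Fin (n + 1)}
    (hne : R.exit v (w i) ≠ v) : ∃ k, i < k ∧ R.corner (w k) = R.exit v (w i) := by
  have hmem : ∀ i, w i ∈ R.breakSet v := fun i => hr ▸ ⟨i, rfl⟩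
  obtain ⟨_, hw', hc⟩ := R.exists_mem_breakSet_corner_eq hfree
    (Or.inr ⟨w i, (hmem i).1, rfl⟩) hne
  obtain ⟨k, rfl⟩ := hr ▸ hw'
  refine ⟨k, ?_, hc⟩
  by_contra hik
  rcases (not_lt.1 hik).eq_or_lt with rfl | hki
  · exact R.corner_ne_exit hfree hw' hc
  · have h1 := R.exit_treeLE_corner hfree (hmem i).2.1 (hlt k i hki).1 (hmem i).1 (hlt k i hki).2
    have h2 := R.corner_treeLE_exit hfree (hmem i)
    refine R.corner_ne_exit hfree hw' (R.treeLE_antisymm (R.corner_treeLE_exit hfree hw') ?_)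
    rw [hc]
    exact R.treeLE_trans h1 h2

theorem ends_succ (hfree : ∀ (h : H) (x : X), h • x = x → h = 1)
    (hr : Set.range w = R.breakSet v)
    (hlt : ∀ i j, i < j → R.TreeLE (w i) (w j) ∧ w i ≠ w j) (i : Fin (n + 1)) :
    R.ends w v i.succ = R.exit v (w i) := by
  have hmem : ∀ i, w i ∈ R.breakSet v := fun i => hr ▸ ⟨i, rfl⟩
  have hle : ∀ i j, i < j → R.TreeLE (R.exit v (w i)) (R.corner (w j)) := fun i j hij =>
    R.exit_treeLE_corner hfree (hmem j).2.1 (hlt i j hij).1 (hmem j).1 (hlt i j hij).2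
  induction i using Fin.lastCases with
  | last =>
    rw [Fin.succ_last, ends, Fin.snoc_last]
    by_contra hne
    obtain ⟨k, hk, -⟩ := R.exists_lt_corner_eq_exit hfree hr hlt (Ne.symm hne)
    exact absurd (Fin.le_last k) (not_le.2 hk)
  | cast j =>
    rw [Fin.succ_castSucc, ends_castSucc]
    have hjs : j.castSucc < j.succ := Fin.castSucc_lt_succ
    have h1 := hle _ _ hjs
    have hne : R.exit v (w j.castSucc) ≠ v := by
      intro h
      rw [h] at h1
      refine R.corner_ne_exit hfree (hmem j.succ) (R.treeLE_antisymm
        (R.corner_treeLE_exit hfree (hmem _)) ?_)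
      exact R.treeLE_trans (R.treeLE_exit hfree (hmem _).1).2 h1
    obtain ⟨k, hk, hc⟩ := R.exists_lt_corner_eq_exit hfree hr hlt hne
    have hjk : j.succ ≤ k := by
      rw [Fin.lt_def, Fin.val_castSucc] at hk
      rw [Fin.le_def, Fin.val_succ]
      exact hk
    rcases hjk.eq_or_lt with rfl | hk'
    · exact hc
    -- If the exit were the corner of a later `w k`, the corner and the exit of the skipped `w
    -- j.succ` would be squeezed together.
    · exfalso
      have h2 := hle _ _ hk'
      rw [hc] at h2
      exact R.corner_ne_exit hfree (hmem j.succ) (R.treeLE_antisymm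
        (R.corner_treeLE_exit hfree (hmem _)) (R.treeLE_trans h2 h1))

end Enumeration

/-! ### Orbit representatives with a prescribed base point. -/

theorem exists_base_eq (b₁ : X) :
    ∃ R : OrbitReps H X, R.base = b₁ := by
  classical
  let f : MulAction.orbitRel.Quotient H X → X := Function.update Quotient.out
    (Quotient.mk (MulAction.orbitRel H X) b₁) b₁
  have hf : ∀ q, Quotient.mk (MulAction.orbitRel H X) (f q) = q := by
    intro q
    by_cases hq : q = Quotient.mk (MulAction.orbitRel H X) b₁
    · subst hq
      simp [f]
    · simp [f, hq]
  refine ⟨⟨Set.range f, b₁, ⟨Quotient.mk (MulAction.orbitRel H X) b₁, by simp [f]⟩, ?_⟩, rfl⟩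
  intro x
  refine ⟨f (Quotient.mk (MulAction.orbitRel H X) x), ⟨⟨_, rfl⟩, ?_⟩, ?_⟩
  · exact MulAction.orbitRel_apply.1 (Quotient.exact (hf (Quotient.mk _ x)).symm)
  · rintro _ ⟨⟨q, rfl⟩, hx⟩
    have : Quotient.mk (MulAction.orbitRel H X) x = Quotient.mk _ (f q) :=
      Quotient.sound (MulAction.orbitRel_apply.2 hx)
    rw [this, hf]

end OrbitReps

end FreeMedian

/-! ### Assembly of the theorem. -/

theorem theorem3p1 {H X : Type*} [Group H] [MulAction H X]
    (hfree : ∀ (h : H) (x : X), h • x = x → h = 1) :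
    -- every point is the base point of some system of orbit representatives
    (∀ b₁ : X, ∃ R : FreeMedian.OrbitReps H X, R.base = b₁) ∧
    ∀ R : FreeMedian.OrbitReps H X,
    -- the tree order is an order-tree with root `1`, with meets, and `Y` is its tree median
    ((∀ u, R.TreeLE u u) ∧
      (∀ u v, R.TreeLE u v → R.TreeLE v u → u = v) ∧
      (∀ u v w, R.TreeLE u v → R.TreeLE v w → R.TreeLE u w) ∧
      (∀ u, R.TreeLE 1 u) ∧
      (∀ u v w, R.TreeLE u w → R.TreeLE v w → R.TreeLE u v ∨ R.TreeLE v u) ∧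
      (∀ u v, R.IsTreeMeet u v (R.treeMeet u v)) ∧
      (∀ u v w, R.IsTreeMedian u v w (R.treeMedian u v w)) ∧
      (∀ w, R.IsRetractOf w (R.retract w))) ∧
    -- the free product contains `H` as a subgroup and `X` as a generating `H`-subset, with
    -- an equivariant retract
    (Function.Injective R.incl ∧
      Function.Injective R.emb ∧
      (∀ (h : H), ∀ b ∈ R.reps, R.emb (h • b) = R.incl h * R.letter b) ∧
      (∀ (h : H) (x : X), R.emb (h • x) = R.incl h * R.emb x) ∧
      (∀ (h : H) (u : R.Hat), R.retract (R.incl h * u) = h • R.retract u) ∧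
      (∀ x : X, R.retract (R.emb x) = x) ∧
      R.emb R.base = 1 ∧
      R.emb '' MulAction.orbit H R.base = Set.range R.incl ∧
      Subgroup.closure (Set.range R.emb) = ⊤) ∧
    -- for the operations in question, `X` is a retractible convex subset and restriction to `X`
    -- is restriction
    (∀ M ∈ R.medianGroupOps,
      FreeMedian.IsRetractibleVia M (Set.range R.emb) (fun w => R.emb (R.retract w)) ∧
      ∀ x y z : X, R.emb (R.res M x y z) = M (R.emb x) (R.emb y) (R.emb z)) ∧
    -- restriction is bijective, also on locally linear and on simplicial operations
    Set.BijOn R.res R.medianGroupOps (FreeMedian.medianOps H X) ∧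
    Set.BijOn R.res {M | M ∈ R.medianGroupOps ∧ FreeMedian.IsLocallyLinear M}
      {m | m ∈ FreeMedian.medianOps H X ∧ FreeMedian.IsLocallyLinear m} ∧
    Set.BijOn R.res {M | M ∈ R.medianGroupOps ∧ FreeMedian.IsSimplicial M}
      {m | m ∈ FreeMedian.medianOps H X ∧ FreeMedian.IsSimplicial m} ∧
    -- the explicit extension
    (∀ m ∈ FreeMedian.medianOps H X,
      R.ext m ∈ R.medianGroupOps ∧
      (∀ x y z : X, R.ext m (R.emb x) (R.emb y) (R.emb z) = R.emb (m x y z)) ∧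
      (∀ M ∈ R.medianGroupOps,
        (∀ x y z : X, M (R.emb x) (R.emb y) (R.emb z) = R.emb (m x y z)) → M = R.ext m) ∧
      (FreeMedian.IsLocallyLinear m → FreeMedian.IsLocallyLinear (R.ext m)) ∧
      (FreeMedian.IsSimplicial m → FreeMedian.IsSimplicial (R.ext m)) ∧
      -- the induced meet-semilattice operation
      (∀ u v : R.Hat, R.ext m u 1 v =
        R.treeMeet u v * R.emb (m (R.retract ((R.treeMeet u v)⁻¹ * u))
          (R.retract (R.treeMeet u v)⁻¹) (R.retract ((R.treeMeet u v)⁻¹ * v)))) ∧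
      -- the induced partial order
      (∀ u v : R.Hat, R.ext m u 1 v = u ↔
        (R.treeMeet u v)⁻¹ * u ∈ R.emb '' FreeMedian.cell m (R.retract (R.treeMeet u v)⁻¹)
          (R.retract ((R.treeMeet u v)⁻¹ * v))) ∧
      (∀ u v : R.Hat, R.TreeLE u v →
        R.base ∈ FreeMedian.cell m (R.retract u⁻¹) (R.retract (u⁻¹ * v)) →
        R.ext m u 1 v = u)) ∧
    -- the decomposition of the cells `[1, v]`
    (∀ v : R.Hat, v ≠ 1 → ∃ (n : ℕ) (w : Fin (n + 1) → R.Hat),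
      Set.range w = R.breakSet v ∧
      (∀ i j, i < j → R.TreeLE (w i) (w j) ∧ w i ≠ w j) ∧
      R.ends w v 0 = 1 ∧
      (∀ i : Fin (n + 1),
        R.TreeLE (R.ends w v i.castSucc) (w i) ∧
        R.TreeLE (w i) (R.ends w v i.succ) ∧
        R.ends w v i.castSucc ≠ R.ends w v i.succ ∧
        R.ends w v i.succ = w i * R.emb (R.retract ((w i)⁻¹ * v))) ∧
      ∀ m ∈ FreeMedian.medianOps H X,
        (∀ i : Fin (n + 1),
          R.ext m (R.ends w v i.castSucc) 1 (R.ends w v i.succ) = R.ends w v i.castSucc) ∧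
        FreeMedian.cell (R.ext m) 1 v =
          ⋃ i : Fin (n + 1),
            FreeMedian.cell (R.ext m) (R.ends w v i.castSucc) (R.ends w v i.succ) ∧
        (∀ i : Fin (n + 1),
          FreeMedian.cell (R.ext m) (R.ends w v i.castSucc) (R.ends w v i.succ) =
            (fun x => w i * R.emb x) ''
              FreeMedian.cell m (R.retract (w i)⁻¹) (R.retract ((w i)⁻¹ * v))) ∧
        (∀ i j : Fin (n + 1), i < j →
          ∀ u ∈ FreeMedian.cell (R.ext m) (R.ends w v i.castSucc) (R.ends w v i.succ),
          ∀ u' ∈ FreeMedian.cell (R.ext m) (R.ends w v j.castSucc) (R.ends w v j.succ),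
            R.ext m u 1 u' = u) ∧
        (∀ i : Fin (n + 1),
          ∀ x ∈ FreeMedian.cell m (R.retract (w i)⁻¹) (R.retract ((w i)⁻¹ * v)),
          ∀ x' ∈ FreeMedian.cell m (R.retract (w i)⁻¹) (R.retract ((w i)⁻¹ * v)),
            (R.ext m (w i * R.emb x) 1 (w i * R.emb x') = w i * R.emb x ↔
              x ∈ FreeMedian.cell m (R.retract (w i)⁻¹) x'))) := by
  refine ⟨FreeMedian.OrbitReps.exists_base_eq, fun R => ⟨⟨R.treeLE_refl,
    fun _ _ => R.treeLE_antisymm, fun _ _ _ => R.treeLE_trans, R.one_treeLE,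
    fun _ _ _ => R.treeLE_total, R.isTreeMeet_treeMeet,
    fun u v w => (R.isTreeMedian_and_mem u v w).1, R.isRetractOf_retract hfree⟩,
    ⟨R.incl_injective hfree, R.emb_injective hfree, fun h _ hb => R.emb_smul_rep hfree h hb,
      R.emb_smul hfree, R.retract_incl_mul hfree, R.retract_emb hfree, R.emb_base hfree,
      R.emb_image_orbit_base hfree, R.closure_range_emb hfree⟩,
    fun M hM => ⟨R.isRetractibleVia_range_emb hfree hM, R.emb_res hfree hM⟩, ?_, ?_, ?_, ?_, ?_⟩⟩
  · exact Set.InvOn.bijOn (f' := R.ext)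
      ⟨fun M hM => R.ext_res hfree hM, fun m hm => R.res_ext hfree hm⟩
      (fun M hM => R.res_mem_medianOps hfree hM) fun m hm => R.ext_mem_medianGroupOps hfree hm
  · exact Set.InvOn.bijOn (f' := R.ext)
      ⟨fun M hM => R.ext_res hfree hM.1, fun m hm => R.res_ext hfree hm.1⟩
      (fun M hM => ⟨R.res_mem_medianOps hfree hM.1, R.isLocallyLinear_res hfree hM.1 hM.2⟩)
      fun m hm => ⟨R.ext_mem_medianGroupOps hfree hm.1, R.isLocallyLinear_ext hfree hm.1 hm.2⟩
  · exact Set.InvOn.bijOn (f' := R.ext)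
      ⟨fun M hM => R.ext_res hfree hM.1, fun m hm => R.res_ext hfree hm.1⟩
      (fun M hM => ⟨R.res_mem_medianOps hfree hM.1, R.isSimplicial_res hfree hM.1 hM.2⟩)
      fun m hm => ⟨R.ext_mem_medianGroupOps hfree hm.1, R.isSimplicial_ext hfree hm.1 hm.2⟩
  · intro m hm
    refine ⟨R.ext_mem_medianGroupOps hfree hm, R.ext_emb hfree hm, fun M hM h => ?_,
      R.isLocallyLinear_ext hfree hm, R.isSimplicial_ext hfree hm, R.ext_one m,
      R.ext_one_eq_left_iff hfree hm, fun _ _ => R.ext_one_eq_left_of_treeLE hfree hm⟩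
    have : R.res M = m := by
      funext x y z
      rw [FreeMedian.OrbitReps.res, h, R.retract_emb hfree]
    rw [← this, R.ext_res hfree hM]
  · intro v hv
    obtain ⟨w₀, hw₀, -⟩ := R.exists_mem_breakSet_corner_eq hfree (Or.inl rfl) hv.symm
    obtain ⟨n, w, hr, hlt⟩ := R.exists_enum v ⟨w₀, hw₀⟩
    have hmem : ∀ i, w i ∈ R.breakSet v := fun i => hr ▸ ⟨i, rfl⟩
    have hsucc := R.ends_succ hfree hr hlt
    refine ⟨n, w, hr, hlt, R.ends_zero hfree hv hr hlt, fun i => ?_, fun m hm => ?_⟩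
    · rw [R.ends_castSucc, hsucc]
      exact ⟨R.corner_treeLE hfree (hmem i).2.1, (R.treeLE_exit hfree (hmem i).1).1,
        R.corner_ne_exit hfree (hmem i), rfl⟩
    have hM := R.isMedian_ext hfree hm
    have hcell : ∀ i : Fin (n + 1),
        FreeMedian.cell (R.ext m) (R.ends w v i.castSucc) (R.ends w v i.succ) =
          (fun x => w i * R.emb x) ''
            FreeMedian.cell m (R.retract (w i)⁻¹) (R.retract ((w i)⁻¹ * v)) := fun i => by
      rw [R.ends_castSucc, hsucc]
      exact R.cell_ext_mul_emb hfree hm _ _ _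
    have hbelow : ∀ (i : Fin (n + 1)) (x : X) (q : R.Hat),
        R.retract (w i)⁻¹ ≠ R.retract ((w i)⁻¹ * q) →
        x ∈ FreeMedian.cell m (R.retract (w i)⁻¹) (R.retract ((w i)⁻¹ * q)) →
        R.ext m (w i * R.emb x) 1 q = w i * R.emb x := fun i x q hne hx => by
      rw [R.ext_one_eq_left_iff_mem_cell hfree hm]
      rw [← congrArg R.retract (mul_one (w i)⁻¹)] at hx hne
      exact R.mul_emb_mem_cell hfree hm hne hx
    refine ⟨fun i => ?_, ?_, hcell, fun i j hij u hu u' hu' => ?_, fun i x hx x' hx' => ?_⟩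
    · rw [R.ends_castSucc, hsucc]
      have e : (w i)⁻¹ * R.exit v (w i) = R.emb (R.retract ((w i)⁻¹ * v)) :=
        inv_mul_cancel_left _ _
      refine hbelow i _ _ ?_ (hm.1.left_mem_cell _ _)
      rw [e, R.retract_emb hfree]
      exact R.retract_inv_ne hfree (hmem i)
    · simp only [hcell]
      rw [R.cell_ext_one hfree hm hv, ← hr, Set.biUnion_range]
    · rw [hcell] at hu hu'
      obtain ⟨x, hx, rfl⟩ := hu
      obtain ⟨y, hy, rfl⟩ := hu'
      obtain ⟨hle, hne⟩ := hlt i j hij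
      -- Seen from an earlier translate, a whole later translate projects to the same point as `v`.
      have e : R.retract ((w i)⁻¹ * (w j * R.emb y)) = R.retract ((w i)⁻¹ * v) := by
        rw [← mul_assoc, R.retract_mul_emb hfree
          (R.inv_mul_notMem_range_incl hfree (hmem i).2.1 (hmem j).2.1 hne),
          R.retract_inv_mul_eq hfree (hmem j).2.1 hle (hmem j).1 hne]
      refine hbelow i x _ ?_ ?_
      · rw [e]
        exact R.retract_inv_ne hfree (hmem i)
      · rwa [e]
    · have e : R.retract ((w i)⁻¹ * (w i * R.emb x')) = x' := by
        rw [inv_mul_cancel_left, R.retract_emb hfree]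
      constructor
      · intro h
        rw [R.ext_one_eq_left_iff_mem_cell hfree hm, R.ext_mem_cell_iff hfree hm] at h
        have h := h (w i)⁻¹
        rwa [mul_one, e, inv_mul_cancel_left, R.retract_emb hfree] at h
      · intro h
        -- `hbelow` needs distinct projections; if they agree, the cell is a point and `x = x'`.
        by_cases hne : R.retract (w i)⁻¹ = x'
        · rw [hne] at h
          rw [hm.1.eq_of_mem_cell_self h]
          exact hM.absorb _ _
        · refine hbelow i x _ ?_ ?_
          · rwa [e]
          · rwa [e]
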